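/- Let $m\ge 0$ and $n\ge 1$ be integers, and let $m$ balls be distributed independently of each other into $n$ boxes, each ball landing in box $i$ with probability $p_i$, where $p_i\ge 0$ and $\sum_{i=1}^n p_i=1$. Let $\xi_i$ be the number of balls in box $i$. For functions $h_i:\mathbb{Z}_+\to\mathbb{R}$ ($1\le i\le n$) let $$U=\sum_{i=1}^n h_i(\xi_i),\qquad \mu=\mathbb{E}U,\qquad \sigma^2=\operatorname{Var}U,\qquad W=\frac{U-\mu}{\sigma},$$ where $\sigma\ge 0$, and write $$\|h\|=\sup_{1\le i\le n}\sup_{j\in\mathbb{Z}_+}|h_i(j)|,\qquad \|\Delta h\|=\sup_{1\le i\le n}\sup_{j\in\mathbb{Z}_+}|h_i(j+1)-h_i(j)|,\qquad \bar p=\sup_{1\le i\le n}p_i .$$ For probability laws $P,Q$ on $\mathbb{R}$ let $d_{\mathrm K}(P,Q)=\sup_{x\in\mathbb{R}}|P((-\infty,x])-Q((-\infty,x])|$ be the Kolmogorov distance. **(Theorem.)** Assume that $\sigma>0$, that $h_i(0)=0$ for all $i$, that $1\le\|h\|<\infty$ and $\|\Delta h\|\ge 1$, and that $$1+10m\bar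 p\;\le\;4\ln(n\|h\|)\;\le\;\frac{1}{(2\bar p)^{1/2}} .$$ Then $$d_{\mathrm K}\bigl(\mathscr{L}(W),\mathrm{N}(0,1)\bigr)\;\le\;\frac{409600\,n\,\|\Delta h\|^3\,\ln(n\|h\|)^6\,(1+\sigma^2/n)}{\sigma^3}+\frac{3888\,\ln(n\|h\|)^2}{\sigma^2}.$$ **(Corollary.)** Consider a sequence of such occupancy schemes whose number of boxes $n$ tends to infinity, where $m$, $(p_i)$ and $(h_i)$ may all vary along the sequence and $\operatorname{Var}U>0$ throughout (here neither $h_i(0)=0$ nor the boundedness of $h$ is required). If (i) $\|\Delta h\|$ remains bounded, (ii) $m\bar p=O(\ln n)$, (iii) $\ln(n)^4\,n^{2/3}/\operatorname{Var}U\to 0$, (iv) $\bar p=O(\ln(n)^{-2})$, then $U$ is asymptotically normal, that is, $W$ converges in distribution to $\mathrm{N}(0,1)$. -/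

import Mathlib

open MeasureTheory ProbabilityTheory Filter Asymptotics
open scoped Topology

noncomputable section

namespace Occupancy

/-- The Kolmogorov (uniform) distance between two laws on the real line,
`sup_x |P((-∞, x]) - Q((-∞, x])|`.  For probability measures the supremum is over a family
bounded by `1`. -/
def kolmogorovDist (P Q : Measure ℝ) : ℝ :=
  ⨆ x : ℝ, |P.real (Set.Iic x) - Q.real (Set.Iic x)|

/-- `p` is a vector of box probabilities: nonnegative entries summing to one. -/
def IsProbVector {n : ℕ} (p : Fin n → ℝ) : Prop :=
  (∀ i, 0 ≤ p i) ∧ ∑ i, p i = 1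

/-- `m` balls are thrown independently of each other into `n` boxes, each ball landing in box `i`
with probability `p i`; `X k ω` is the box of ball `k`. -/
structure IsOccupancyScheme {Ω : Type*} [MeasurableSpace Ω] {m n : ℕ} (P : Measure Ω)
    (p : Fin n → ℝ) (X : Fin m → Ω → Fin n) : Prop where
  measurable : ∀ k, Measurable (X k)
  indep : iIndepFun X P
  prob_eq : ∀ k i, P.real {ω | X k ω = i} = p i

/-- The number `ξ_i` of balls in box `i`. -/
def boxCount {Ω : Type*} {m n : ℕ} (X : Fin m → Ω → Fin n) (i : Fin n) (ω : Ω) : ℕ :=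
  (Finset.univ.filter fun k => X k ω = i).card

/-- The statistic `U = ∑ i, h_i(ξ_i)`. -/
def statistic {Ω : Type*} {m n : ℕ} (X : Fin m → Ω → Fin n) (h : Fin n → ℕ → ℝ) (ω : Ω) : ℝ :=
  ∑ i, h i (boxCount X i ω)

/-- The standardization `(U - μ) / σ`, where `μ` and `σ²` are the mean and the variance of `U`. -/
def standardize {Ω : Type*} [MeasurableSpace Ω] (P : Measure Ω) (U : Ω → ℝ) (ω : Ω) : ℝ :=
  (U ω - ∫ ω', U ω' ∂P) / √(variance U P)

/-- `‖h‖ = sup_i sup_j |h_i(j)|`. -/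
def supNorm {n : ℕ} (h : Fin n → ℕ → ℝ) : ℝ := ⨆ i, ⨆ j, |h i j|

/-- `‖Δh‖ = sup_i sup_j |h_i(j+1) - h_i(j)|`. -/
def diffNorm {n : ℕ} (h : Fin n → ℕ → ℝ) : ℝ := ⨆ i, ⨆ j, |h i (j + 1) - h i j|

/-- The largest box probability. -/
def maxProb {n : ℕ} (p : Fin n → ℝ) : ℝ := ⨆ i, p i

end Occupancy

end

/-!
The statistic `U` is a function of the `m` independent boxes `X_1, …, X_m` of the balls, and the
normal approximation is proved directly in these variables, without truncating the box counts.
Both conclusions follow from `kolmogorovDist_standardize_le`, a bound of order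
`√m (1 + m p̄) ‖Δh‖² / σ²`, which holds without any condition on `m p̄` or on `‖h‖`.

Let `X'` be an independent copy of `X`. Write `W` for the standardized statistic, `D_k` for its
decrement when `X_k` is replaced by `X'_k`, and `D'_k` for the decrement of the same replacement
once `X_1, …, X_{k-1}` have been replaced. Telescoping `W(X) - W(X')` and exchanging `X_k` with
`X'_k` gives the identity `E[W f(W)] = ½ ∑ E[D'_k (f(W) - f(W - D_k))]` (`prodExp_mul_sub_eq`),
which also implies the Efron–Stein inequality (`variance_le_sum_incr_sq`).

Let `f` solve `f'(w) - w f(w) = 1_{w < x} - Φ(x)`. The derivative `f'` is bounded by `2` and is the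
sum of the increasing function `w f(w)`, a decreasing indicator and a constant
(`monotone_mul_steinSol`). Hence, with `T = ½ ∑ D'_k D_k`, the error `P(W < x) - Φ(x)` is
`E[f'(W) (1 - T)]` plus a remainder at most `½ ∑ E[|D'_k| D_k (g(W) - g(W - D_k))]`, where `g` is
increasing and bounded by `2`. Since `|D'_k| D_k` is antisymmetric under the exchange, the remainder
is at most `E[R g(W)]` with `R = ∑ |D'_k| D_k`, a variable of mean zero
(`abs_prodExp_stepFun_sub_normalCdf_le`). As `E T = 1`, only the variances of `T` and `R` are
needed.

The increments are at most `2 ‖Δh‖ / σ`, and `D_k`, `D'_k` depend on another ball `l` only if it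
shares a box with ball `k` before or after a replacement (`configStat_update_sub_update`). The
number of such `k` has second moment at most `(1 + 12 m p̄)²` (`prodExp_numTouch_sq_le`), so the
Efron–Stein inequality bounds both variances (`prodExp_abs_sub_le`).

Since `n p̄ ≥ 1`, one has `m ≤ n (m p̄)`, and `2 √n σ ≤ n + σ²` turns the bound into the stated
explicit one.
-/

namespace Occupancy

/-! ### The standard normal law and the Stein equation -/

/-- The standard normal distribution function. -/
noncomputable def normalCdf (w : ℝ) : ℝ := (gaussianReal 0 1).real (Set.Iic w)

/-- The standard normal density. -/
noncomputable def normalPdf (w : ℝ) : ℝ := gaussianPDFReal 0 1 w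

lemma normalPdf_eq (w : ℝ) : normalPdf w = (√(2 * Real.pi))⁻¹ * Real.exp (-w ^ 2 / 2) := by
  simp [normalPdf, gaussianPDFReal]

lemma normalPdf_pos (w : ℝ) : 0 < normalPdf w := gaussianPDFReal_pos 0 1 w one_ne_zero

lemma normalPdf_neg (w : ℝ) : normalPdf (-w) = normalPdf w := by
  simp [normalPdf_eq]

lemma continuous_normalPdf : Continuous normalPdf := by
  rw [funext normalPdf_eq]
  fun_prop

lemma integrable_normalPdf : Integrable normalPdf := integrable_gaussianPDFReal 0 1

lemma hasDerivAt_normalPdf (w : ℝ) : HasDerivAt normalPdf (-w * normalPdf w) w := by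
  have h : HasDerivAt (fun w : ℝ => (√(2 * Real.pi))⁻¹ * Real.exp (-w ^ 2 / 2))
      ((√(2 * Real.pi))⁻¹ * (Real.exp (-w ^ 2 / 2) * (-(2 * w ^ 1) / 2))) w := by
    have := ((hasDerivAt_pow 2 w).neg.div_const 2).exp.const_mul (√(2 * Real.pi))⁻¹
    simpa using this
  rw [funext normalPdf_eq]
  convert h using 1
  ring

lemma normalCdf_eq_integral (w : ℝ) : normalCdf w = ∫ t in Set.Iic w, normalPdf t := by
  rw [normalCdf, measureReal_def, gaussianReal_apply_eq_integral 0 one_ne_zero,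
    ENNReal.toReal_ofReal]
  · rfl
  · exact integral_nonneg fun t => (gaussianPDFReal_nonneg 0 1 t)

lemma normalCdf_nonneg (w : ℝ) : 0 ≤ normalCdf w := measureReal_nonneg

lemma normalCdf_le_one (w : ℝ) : normalCdf w ≤ 1 := measureReal_le_one

lemma normalCdf_neg (w : ℝ) : normalCdf (-w) = 1 - normalCdf w := by
  have h1 : (gaussianReal 0 1).map (fun x : ℝ => -x) = gaussianReal 0 1 := by
    rw [gaussianReal_map_neg, neg_zero]
  have h2 : normalCdf (-w) = (gaussianReal 0 1).real (Set.Ici w) := by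
    rw [normalCdf]
    nth_rewrite 1 [← h1]
    rw [map_measureReal_apply measurable_neg measurableSet_Iic]
    congr 1
    ext x
    simp
  have := nullSingletonClass_gaussianReal (μ := 0) (v := 1) one_ne_zero
  have h3 : (gaussianReal 0 1).real (Set.Ici w) = (gaussianReal 0 1).real (Set.Ioi w) :=
    measureReal_congr Ioi_ae_eq_Ici.symm
  rw [h2, h3, ← Set.compl_Iic, probReal_compl_eq_one_sub measurableSet_Iic, normalCdf]

lemma hasDerivAt_normalCdf (w : ℝ) : HasDerivAt normalCdf (normalPdf w) w := by
  have h : normalCdf = fun w => normalCdf 0 + ∫ t in (0 : ℝ)..w, normalPdf t := by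
    funext w
    rw [normalCdf_eq_integral, normalCdf_eq_integral, ← intervalIntegral.integral_Iic_sub_Iic
      integrable_normalPdf.integrableOn integrable_normalPdf.integrableOn]
    ring
  rw [h]
  exact (intervalIntegral.integral_hasDerivAt_right
    integrable_normalPdf.intervalIntegrable
    continuous_normalPdf.stronglyMeasurable.stronglyMeasurableAtFilter
    continuous_normalPdf.continuousAt).const_add _

lemma integrable_id_mul_normalPdf : Integrable fun t => t * normalPdf t := by
  have := (integrable_mul_exp_neg_mul_sq (b := 1 / 2) (by norm_num)).const_mul
    (√(2 * Real.pi))⁻¹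
  refine this.congr (ae_of_all _ fun t => ?_)
  simp only [normalPdf_eq]
  rw [show -(1 / 2) * t ^ 2 = -t ^ 2 / 2 by ring]
  ring

lemma tendsto_normalPdf_atBot : Tendsto normalPdf atBot (𝓝 0) := by
  have h : Tendsto (fun w : ℝ => (√(2 * Real.pi))⁻¹ * Real.exp (-w ^ 2 / 2)) atBot (𝓝 0) := by
    rw [← mul_zero (√(2 * Real.pi))⁻¹]
    refine Tendsto.const_mul _ (Real.tendsto_exp_atBot.comp ?_)
    have := (tendsto_pow_atTop (α := ℝ) two_ne_zero).comp tendsto_neg_atBot_atTop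
    have h2 := tendsto_neg_atTop_atBot.comp (this.atTop_div_const (show (0 : ℝ) < 2 by norm_num))
    refine h2.congr fun x => ?_
    simp only [Function.comp]
    ring
  rwa [← funext normalPdf_eq] at h

lemma tendsto_id_mul_normalPdf_atBot : Tendsto (fun w => w * normalPdf w) atBot (𝓝 0) := by
  have h0 : Tendsto (fun x : ℝ => x ^ (1 : ℝ) * Real.exp (-(1 / 2) * x ^ 2)) atTop (𝓝 0) := by
    have := rexp_neg_quadratic_isLittleO_rpow_atTop (a := -(1 / 2)) (by norm_num) 0 (-1)
    have h2 := this.tendsto_div_nhds_zero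
    refine h2.congr' ?_
    filter_upwards [eventually_gt_atTop 0] with x hx
    rw [Real.rpow_neg hx.le, div_inv_eq_mul, mul_comm]
    simp
  have h1 := ((h0.comp tendsto_neg_atBot_atTop).const_mul (-(√(2 * Real.pi))⁻¹))
  rw [mul_zero] at h1
  refine h1.congr fun x => ?_
  simp only [Function.comp, normalPdf_eq, Real.rpow_one]
  rw [show -(1 / 2) * (-x) ^ 2 = -x ^ 2 / 2 by ring]
  ring

/-- The lower-tail Mills bound `-w Φ(w) ≤ φ(w)`, from
`φ(w) + w Φ(w) = ∫_{t ≤ w} (w - t) φ(t) dt`. -/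
lemma normalPdf_add_mul_normalCdf_nonneg (w : ℝ) : 0 ≤ normalPdf w + w * normalCdf w := by
  have hi : Integrable fun t => -t * normalPdf t :=
    integrable_id_mul_normalPdf.neg.congr (ae_of_all _ fun t => by simp)
  have h1 : ∫ t in Set.Iic w, -t * normalPdf t = normalPdf w - 0 :=
    integral_Iic_of_hasDerivAt_of_tendsto' (fun x _ => hasDerivAt_normalPdf x)
      hi.integrableOn tendsto_normalPdf_atBot
  have h2 : 0 ≤ ∫ t in Set.Iic w, (-t * normalPdf t + w * normalPdf t) :=
    setIntegral_nonneg measurableSet_Iic fun t ht => by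
      have : (w - t) * normalPdf t = -t * normalPdf t + w * normalPdf t := by ring
      rw [← this]
      exact mul_nonneg (sub_nonneg.2 ht) (normalPdf_pos t).le
  rw [integral_add hi.integrableOn (integrable_normalPdf.const_mul w).integrableOn,
    integral_const_mul, h1, ← normalCdf_eq_integral] at h2
  linarith

/-- The second-order Mills bound; the derivative of the expression is
`2 (φ(w) + w Φ(w)) ≥ 0`, and the expression is at least `w φ(w)`, which vanishes at `-∞`. -/
lemma one_add_sq_mul_normalCdf_add_nonneg (w : ℝ) :
    0 ≤ (1 + w ^ 2) * normalCdf w + w * normalPdf w := by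
  set v : ℝ → ℝ := fun w => (1 + w ^ 2) * normalCdf w + w * normalPdf w with hv
  have hd : ∀ w, HasDerivAt v (2 * (normalPdf w + w * normalCdf w)) w := by
    intro w
    have := (((hasDerivAt_pow 2 w).const_add 1).mul (hasDerivAt_normalCdf w)).add
      ((hasDerivAt_id w).mul (hasDerivAt_normalPdf w))
    refine this.congr_deriv ?_
    simp only [Nat.cast_ofNat, Nat.add_one_sub_one, pow_one, id_eq, one_mul]
    ring
  have hm : Monotone v := monotone_of_hasDerivAt_nonneg hd fun w => by
    have := normalPdf_add_mul_normalCdf_nonneg w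
    change 0 ≤ _
    linarith
  refine le_of_tendsto tendsto_id_mul_normalPdf_atBot ?_
  filter_upwards [eventually_le_atBot w] with u hu
  have h1 : v u ≤ v w := hm hu
  have h2 : 0 ≤ (1 + u ^ 2) * normalCdf u := mul_nonneg (by positivity) (normalCdf_nonneg u)
  simp only [hv] at h1
  linarith

/-- The ratio `Φ / φ`; it solves `ψ' = 1 + w ψ`. -/
noncomputable def millsRatio (w : ℝ) : ℝ := normalCdf w / normalPdf w

lemma hasDerivAt_millsRatio (w : ℝ) : HasDerivAt millsRatio (1 + w * millsRatio w) w := by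
  have h := (hasDerivAt_normalCdf w).div (hasDerivAt_normalPdf w) (normalPdf_pos w).ne'
  refine h.congr_deriv ?_
  have := (normalPdf_pos w).ne'
  rw [millsRatio]
  field_simp
  ring

lemma neg_one_le_mul_millsRatio (w : ℝ) : -1 ≤ w * millsRatio w := by
  rw [millsRatio, ← mul_div_assoc, le_div_iff₀ (normalPdf_pos w)]
  linarith [normalPdf_add_mul_normalCdf_nonneg w]

lemma monotone_mul_millsRatio : Monotone fun w => w * millsRatio w := by
  have hd : ∀ w, HasDerivAt (fun w => w * millsRatio w)
      (1 * millsRatio w + w * (1 + w * millsRatio w)) w := fun w =>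
    (hasDerivAt_id w).mul (hasDerivAt_millsRatio w)
  refine monotone_of_hasDerivAt_nonneg hd fun w => ?_
  have h : 1 * millsRatio w + w * (1 + w * millsRatio w)
      = ((1 + w ^ 2) * normalCdf w + w * normalPdf w) / normalPdf w := by
    have := (normalPdf_pos w).ne'
    rw [millsRatio]
    field_simp
    ring
  change 0 ≤ _
  rw [h]
  exact div_nonneg (one_add_sq_mul_normalCdf_add_nonneg w) (normalPdf_pos w).le

/-- The bounded solution of the Stein equation `f'(w) - w f(w) = 1_{w < x} - Φ(x)`. -/
noncomputable def steinSol (x w : ℝ) : ℝ :=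
  if w < x then normalCdf (-x) * millsRatio w else normalCdf x * millsRatio (-w)

lemma steinSol_of_le {x w : ℝ} (h : w ≤ x) : steinSol x w = normalCdf (-x) * millsRatio w := by
  rcases h.lt_or_eq with h | rfl
  · rw [steinSol, if_pos h]
  · rw [steinSol, if_neg (lt_irrefl _), millsRatio, millsRatio, normalPdf_neg]
    ring

lemma steinSol_of_ge {x w : ℝ} (h : x ≤ w) : steinSol x w = normalCdf x * millsRatio (-w) := by
  rw [steinSol, if_neg (not_lt.2 h)]

/-- The indicator of `(-∞, x)`. -/
noncomputable def stepFun (x w : ℝ) : ℝ := if w < x then 1 else 0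

lemma stepFun_mem (x w : ℝ) : 0 ≤ stepFun x w ∧ stepFun x w ≤ 1 := by
  unfold stepFun
  split_ifs <;> norm_num

lemma antitone_stepFun (x : ℝ) : Antitone (stepFun x) := by
  intro a b h
  unfold stepFun
  split_ifs <;> norm_num
  linarith

/-- The right derivative of `steinSol x`. -/
noncomputable def steinDeriv (x w : ℝ) : ℝ := w * steinSol x w + stepFun x w - normalCdf x

lemma monotone_mul_steinSol (x : ℝ) : Monotone fun w => w * steinSol x w := by
  refine MonotoneOn.Iic_union_Ici (a := x) ?_ ?_
  · intro a ha b hb hab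
    have := mul_le_mul_of_nonneg_left (monotone_mul_millsRatio hab) (normalCdf_nonneg (-x))
    simp only [steinSol_of_le ha, steinSol_of_le hb] at *
    linarith
  · intro a ha b hb hab
    have := mul_le_mul_of_nonneg_left (monotone_mul_millsRatio (neg_le_neg hab))
      (normalCdf_nonneg x)
    simp only [steinSol_of_ge ha, steinSol_of_ge hb] at *
    linarith

lemma abs_mul_steinSol_le_one (x w : ℝ) : |w * steinSol x w| ≤ 1 := by
  rw [abs_le]
  constructor
  · have h := monotone_mul_steinSol x (min_le_left w x)
    have h1 := neg_one_le_mul_millsRatio (min w x)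
    have h2 := normalCdf_nonneg (-x)
    have h3 := normalCdf_le_one (-x)
    simp only [steinSol_of_le (min_le_right w x)] at h
    nlinarith
  · have h := monotone_mul_steinSol x (le_max_left w x)
    have h1 := neg_one_le_mul_millsRatio (-max w x)
    have h2 := normalCdf_nonneg x
    have h3 := normalCdf_le_one x
    simp only [steinSol_of_ge (le_max_right w x)] at h
    nlinarith

lemma abs_steinDeriv_le_two (x w : ℝ) : |steinDeriv x w| ≤ 2 := by
  have h := abs_le.1 (abs_mul_steinSol_le_one x w)
  have h1 := stepFun_mem x w
  have h2 := normalCdf_nonneg x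
  have h3 := normalCdf_le_one x
  rw [steinDeriv, abs_le]
  constructor <;> linarith [h.1, h.2, h1.1, h1.2]

lemma continuous_steinSol (x : ℝ) : Continuous (steinSol x) := by
  have hc : Continuous millsRatio :=
    continuous_iff_continuousAt.2 fun w => (hasDerivAt_millsRatio w).continuousAt
  have h : steinSol x = fun w => if w ≤ x then normalCdf (-x) * millsRatio w
      else normalCdf x * millsRatio (-w) := by
    funext w
    split_ifs with h
    · exact steinSol_of_le h
    · exact steinSol_of_ge (not_le.1 h).le
  rw [h]
  refine Continuous.if_le (by fun_prop) (by fun_prop) continuous_id continuous_const ?_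
  rintro w rfl
  rw [← steinSol_of_le le_rfl, ← steinSol_of_ge le_rfl]

lemma hasDerivWithinAt_steinSol (x w : ℝ) :
    HasDerivWithinAt (steinSol x) (steinDeriv x w) (Set.Ici w) w := by
  rcases lt_or_ge w x with h | h
  · have hd := ((hasDerivAt_millsRatio w).const_mul (normalCdf (-x))).hasDerivWithinAt
      (s := Set.Ici w)
    have he : steinSol x =ᶠ[𝓝[Set.Ici w] w] fun w => normalCdf (-x) * millsRatio w :=
      nhdsWithin_le_nhds ((eventually_lt_nhds h).mono fun u hu => steinSol_of_le hu.le)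
    refine (hd.congr_of_eventuallyEq he (steinSol_of_le h.le)).congr_deriv ?_
    rw [steinDeriv, steinSol_of_le h.le, stepFun, if_pos h, normalCdf_neg]
    ring
  · have hd := (((hasDerivAt_millsRatio (-w)).scomp w (hasDerivAt_neg w)).const_mul
      (normalCdf x)).hasDerivWithinAt (s := Set.Ici w)
    refine (hd.congr (fun u hu => ?_) (steinSol_of_ge h)).congr_deriv ?_
    · exact steinSol_of_ge (h.trans hu)
    · rw [steinDeriv, steinSol_of_ge h, stepFun, if_neg (not_lt.2 h)]
      simp only [smul_eq_mul]
      ring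

/-- First-order Taylor bound for the Stein solution. The derivative is the sum of the increasing
function `w f(w)`, a decreasing indicator and a constant, so on an interval it deviates from its
value at an endpoint by at most the total change of the two monotone parts. -/
lemma abs_steinSol_sub_sub_le (x a b : ℝ) :
    |steinSol x b - steinSol x a - (b - a) * steinDeriv x a| ≤
      |b - a| * (|b * steinSol x b - a * steinSol x a| + |stepFun x b - stepFun x a|) := by
  -- the same estimate on `[l, r]`, for the derivative at any `c` in `{l, r}`
  have key : ∀ l r c C : ℝ, l ≤ r → (∀ t ∈ Set.Ico l r, |steinDeriv x t - steinDeriv x c| ≤ C) →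
      |steinSol x r - steinSol x l - (r - l) * steinDeriv x c| ≤ C * (r - l) := by
    intro l r c C hlr hC
    have := norm_image_sub_le_of_norm_deriv_right_le_segment (a := l) (b := r) (C := C)
      (f := fun t => steinSol x t - t * steinDeriv x c)
      (f' := fun t => steinDeriv x t - steinDeriv x c)
      ((continuous_steinSol x).sub (by fun_prop)).continuousOn
      (fun t _ => by
        have := (hasDerivWithinAt_steinSol x t).sub
          (((hasDerivAt_id t).mul_const (steinDeriv x c)).hasDerivWithinAt (s := Set.Ici t))
        rwa [one_mul] at this) hC r (Set.right_mem_Icc.2 hlr)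
    rw [Real.norm_eq_abs] at this
    convert this using 2
    ring
  rcases le_total a b with h | h
  · rw [abs_of_nonneg (sub_nonneg.2 h), mul_comm (b - a) (_ + _)]
    refine key a b a _ h fun t ht => ?_
    have h1 := monotone_mul_steinSol x ht.1
    have h2 := monotone_mul_steinSol x ht.2.le
    have h3 := antitone_stepFun x ht.1
    have h4 := antitone_stepFun x ht.2.le
    simp only at h1 h2
    rw [steinDeriv, steinDeriv, abs_of_nonneg (by linarith : 0 ≤ b * steinSol x b - _),
      abs_of_nonpos (by linarith : stepFun x b - _ ≤ 0), abs_le]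
    constructor <;> linarith
  · rw [abs_of_nonpos (sub_nonpos.2 h), mul_comm (-(b - a)) (_ + _), neg_sub,
      show steinSol x b - steinSol x a - (b - a) * steinDeriv x a =
        -(steinSol x a - steinSol x b - (a - b) * steinDeriv x a) by ring, abs_neg]
    refine key b a a _ h fun t ht => ?_
    have h1 := monotone_mul_steinSol x ht.1
    have h2 := monotone_mul_steinSol x ht.2.le
    have h3 := antitone_stepFun x ht.1
    have h4 := antitone_stepFun x ht.2.le
    simp only at h1 h2
    rw [steinDeriv, steinDeriv, abs_of_nonpos (by linarith : b * steinSol x b - _ ≤ 0),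
      abs_of_nonneg (by linarith : 0 ≤ stepFun x b - _), abs_le]
    constructor <;> linarith

/-! ### Expectations under finite product laws -/

/-- Probability weights on a finite type. -/
def IsWeight {S : Type*} [Fintype S] (q : S → ℝ) : Prop := (∀ s, 0 ≤ q s) ∧ ∑ s, q s = 1

/-- The expectation of `F` when the `m` coordinates are independent with common weights `q`. -/
def prodExp {S : Type*} [Fintype S] {m : ℕ} (q : S → ℝ) (F : (Fin m → S) → ℝ) : ℝ :=
  ∑ z, (∏ i, q (z i)) * F z

/-- The weights of an independent pair. -/
def pairWeight {S : Type*} (q : S → ℝ) (s : S × S) : ℝ := q s.1 * q s.2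

section Expectation

variable {S : Type*} [Fintype S] {m : ℕ} {q : S → ℝ}

lemma IsWeight.pairWeight (hq : IsWeight q) : IsWeight (pairWeight q) := by
  refine ⟨fun s => mul_nonneg (hq.1 _) (hq.1 _), ?_⟩
  simp only [Occupancy.pairWeight, Fintype.sum_prod_type, ← Finset.mul_sum, hq.2, mul_one]

lemma prodExp_add (F G : (Fin m → S) → ℝ) :
    prodExp q (fun z => F z + G z) = prodExp q F + prodExp q G := by
  simp only [prodExp, mul_add, Finset.sum_add_distrib]

lemma prodExp_sub (F G : (Fin m → S) → ℝ) :
    prodExp q (fun z => F z - G z) = prodExp q F - prodExp q G := by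
  simp only [prodExp, mul_sub, Finset.sum_sub_distrib]

lemma prodExp_const_mul (c : ℝ) (F : (Fin m → S) → ℝ) :
    prodExp q (fun z => c * F z) = c * prodExp q F := by
  simp only [prodExp, Finset.mul_sum]
  exact Finset.sum_congr rfl fun z _ => by ring

lemma prodExp_neg (F : (Fin m → S) → ℝ) : prodExp q (fun z => -F z) = -prodExp q F := by
  simp only [prodExp, mul_neg, Finset.sum_neg_distrib]

lemma prodExp_sum {κ : Type*} (s : Finset κ) (F : κ → (Fin m → S) → ℝ) :
    prodExp q (fun z => ∑ k ∈ s, F k z) = ∑ k ∈ s, prodExp q (F k) := by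
  simp only [prodExp, Finset.mul_sum]
  exact Finset.sum_comm

lemma IsWeight.sum_prod (hq : IsWeight q) : ∑ z : Fin m → S, ∏ i, q (z i) = 1 := by
  have := Finset.prod_univ_sum (fun _ : Fin m => (Finset.univ : Finset S)) (fun _ s => q s)
  rw [Fintype.piFinset_univ] at this
  rw [← this]
  simp [hq.2]

lemma prodExp_const (hq : IsWeight q) (c : ℝ) : prodExp q (fun _ : Fin m → S => c) = c := by
  rw [prodExp, ← Finset.sum_mul, hq.sum_prod, one_mul]

lemma prodExp_mono (hq : IsWeight q) {F G : (Fin m → S) → ℝ} (h : ∀ z, F z ≤ G z) :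
    prodExp q F ≤ prodExp q G :=
  Finset.sum_le_sum fun z _ =>
    mul_le_mul_of_nonneg_left (h z) (Finset.prod_nonneg fun i _ => hq.1 (z i))

lemma prodExp_nonneg (hq : IsWeight q) {F : (Fin m → S) → ℝ} (h : ∀ z, 0 ≤ F z) :
    0 ≤ prodExp q F :=
  Finset.sum_nonneg fun z _ => mul_nonneg (Finset.prod_nonneg fun i _ => hq.1 (z i)) (h z)

lemma abs_prodExp_le (hq : IsWeight q) (F : (Fin m → S) → ℝ) :
    |prodExp q F| ≤ prodExp q (fun z => |F z|) := by
  rw [abs_le, ← prodExp_neg]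
  exact ⟨prodExp_mono hq fun z => neg_abs_le _, prodExp_mono hq fun z => le_abs_self _⟩

lemma prodExp_sub_sq (hq : IsWeight q) (F : (Fin m → S) → ℝ) (c : ℝ) :
    prodExp q (fun z => (F z - c) ^ 2)
      = prodExp q (fun z => F z ^ 2) - 2 * c * prodExp q F + c ^ 2 := by
  have : (fun z => (F z - c) ^ 2) = fun z => (F z ^ 2 - (2 * c) * F z) + c ^ 2 := by
    funext z; ring
  rw [this, prodExp_add, prodExp_sub, prodExp_const_mul, prodExp_const hq]

lemma prodExp_abs_le_sqrt (hq : IsWeight q) (F : (Fin m → S) → ℝ) :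
    prodExp q (fun z => |F z|) ≤ √(prodExp q fun z => F z ^ 2) := by
  refine Real.le_sqrt_of_sq_le ?_
  have h := prodExp_sub_sq hq (fun z => |F z|) (prodExp q fun z => |F z|)
  have h0 : 0 ≤ prodExp q fun z => (|F z| - prodExp q fun z => |F z|) ^ 2 :=
    prodExp_nonneg hq fun z => sq_nonneg _
  simp only [sq_abs] at h
  nlinarith

/-- Averaging over one coordinate first does not change an expectation. -/
lemma prodExp_resample (hq : IsWeight q) (k : Fin m) (F : (Fin m → S) → ℝ) :
    prodExp q F = prodExp q (fun z => ∑ s, q s * F (Function.update z k s)) := by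
  -- exchange the entry `k` with an independent extra value
  let e : (Fin m → S) × S ≃ (Fin m → S) × S :=
    Function.Involutive.toPerm (fun a => (Function.update a.1 k a.2, a.1 k)) (by
      rintro ⟨z, s⟩
      simp)
  have hw : ∀ (z : Fin m → S) (s : S),
      (∏ i, q (Function.update z k s i)) * q (z k) = (∏ i, q (z i)) * q s := by
    intro z s
    rw [← Finset.mul_prod_erase _ _ (Finset.mem_univ k),
      ← Finset.mul_prod_erase _ (fun i => q (z i)) (Finset.mem_univ k),
      Finset.prod_congr rfl (g := fun i => q (z i)) fun i hi => by
        rw [Function.update_of_ne (Finset.ne_of_mem_erase hi)]]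
    simp only [Function.update_self]
    ring
  calc prodExp q F = ∑ a : (Fin m → S) × S, ((∏ i, q (a.1 i)) * q a.2) * F a.1 := by
        rw [Fintype.sum_prod_type, prodExp]
        refine Finset.sum_congr rfl fun z _ => ?_
        simp only
        rw [← Finset.sum_mul, ← Finset.mul_sum, hq.2, mul_one]
    _ = ∑ a : (Fin m → S) × S, ((∏ i, q ((e a).1 i)) * q (e a).2) * F (e a).1 :=
        (Equiv.sum_comp e _).symm
    _ = _ := by
        rw [Fintype.sum_prod_type, prodExp]
        refine Finset.sum_congr rfl fun z _ => ?_
        rw [Finset.mul_sum]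
        refine Finset.sum_congr rfl fun s _ => ?_
        change ((∏ i, q (Function.update z k s i)) * q (z k)) * _ = _
        rw [hw, mul_assoc]
        rfl

end Expectation

/-! ### Exchanging coordinates and the Efron–Stein inequality -/

section Coordinates

variable {S : Type*} {m : ℕ}

/-- The first components of a vector of pairs. -/
def fstVec (z : Fin m → S × S) (i : Fin m) : S := (z i).1

/-- The vector of first components, with the first `j` entries replaced by the second ones. -/
def mix (j : ℕ) (z : Fin m → S × S) (i : Fin m) : S := if i.val < j then (z i).2 else (z i).1

/-- The vector of first components, with only the entry `k` replaced by the second one. -/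
def replaceAt (k : Fin m) (z : Fin m → S × S) : Fin m → S := Function.update (fstVec z) k (z k).2

/-- Exchange the two components at the coordinates below `j`. -/
def swapBelow (j : ℕ) (z : Fin m → S × S) (i : Fin m) : S × S :=
  if i.val < j then (z i).swap else z i

/-- Exchange the two components at the coordinate `k`. -/
def swapAt (k : Fin m) (z : Fin m → S × S) : Fin m → S × S := Function.update z k (z k).swap

/-- The increment of `F` when the first component of coordinate `k` is replaced, taken as the old
value minus the new one. -/
def incr (F : (Fin m → S) → ℝ) (k : Fin m) (z : Fin m → S × S) : ℝ :=
  F (fstVec z) - F (replaceAt k z)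

/-- The increment of `F`, old value minus new one, when coordinate `k` is replaced after all
coordinates below it. -/
def mixIncr (F : (Fin m → S) → ℝ) (k : Fin m) (z : Fin m → S × S) : ℝ :=
  F (mix k.val z) - F (mix (k.val + 1) z)

lemma mix_zero (z : Fin m → S × S) : mix 0 z = fstVec z := by
  funext i
  simp [mix, fstVec]

lemma mix_succ (k : Fin m) (z : Fin m → S × S) :
    mix (k.val + 1) z = Function.update (mix k.val z) k (z k).2 := by
  funext i
  rcases eq_or_ne i k with rfl | h
  · simp [mix]
  · rw [Function.update_of_ne h]
    have : i.val ≠ k.val := fun h' => h (Fin.ext h')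
    have h2 : i.val < k.val + 1 ↔ i.val < k.val := by omega
    simp only [mix, h2]

lemma fstVec_swapAt (k : Fin m) (z : Fin m → S × S) : fstVec (swapAt k z) = replaceAt k z := by
  funext i
  rcases eq_or_ne i k with rfl | h
  · simp [fstVec, swapAt, replaceAt]
  · simp [fstVec, swapAt, replaceAt, h]

lemma replaceAt_swapAt (k : Fin m) (z : Fin m → S × S) : replaceAt k (swapAt k z) = fstVec z := by
  rw [replaceAt, fstVec_swapAt, replaceAt]
  simp [swapAt, fstVec]

lemma mix_swapAt (k : Fin m) (z : Fin m → S × S) :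
    mix k.val (swapAt k z) = mix (k.val + 1) z := by
  rw [mix_succ]
  funext i
  rcases eq_or_ne i k with rfl | h
  · simp [mix, swapAt]
  · simp [mix, swapAt, h]

lemma mix_succ_swapAt (k : Fin m) (z : Fin m → S × S) :
    mix (k.val + 1) (swapAt k z) = mix k.val z := by
  rw [mix_succ, mix_swapAt, mix_succ]
  simp only [Function.update_idem, swapAt, Function.update_self, Prod.snd_swap]
  rw [Function.update_eq_self_iff]
  simp [mix]

lemma incr_swapAt (F : (Fin m → S) → ℝ) (k : Fin m) (z : Fin m → S × S) :
    incr F k (swapAt k z) = -incr F k z := by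
  rw [incr, incr, fstVec_swapAt, replaceAt_swapAt, neg_sub]

lemma mixIncr_swapAt (F : (Fin m → S) → ℝ) (k : Fin m) (z : Fin m → S × S) :
    mixIncr F k (swapAt k z) = -mixIncr F k z := by
  rw [mixIncr, mixIncr, mix_swapAt, mix_succ_swapAt, neg_sub]

lemma fstVec_swapBelow (j : ℕ) (z : Fin m → S × S) : fstVec (swapBelow j z) = mix j z := by
  funext i
  simp only [fstVec, swapBelow, mix]
  split_ifs <;> rfl

lemma incr_swapBelow (F : (Fin m → S) → ℝ) (k : Fin m) (z : Fin m → S × S) :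
    incr F k (swapBelow k.val z) = mixIncr F k z := by
  rw [incr, mixIncr, replaceAt, fstVec_swapBelow, mix_succ]
  simp [swapBelow]

end Coordinates

section Exchange

variable {S : Type*} [Fintype S] {m : ℕ} {q : S → ℝ}

/-- A product law is invariant under an involution that fixes the weights. -/
lemma prodExp_comp_involutive {T : Type*} [Fintype T] {w : T → ℝ}
    {σ : (Fin m → T) → Fin m → T} (hσ : Function.Involutive σ)
    (hw : ∀ z i, w (σ z i) = w (z i)) (F : (Fin m → T) → ℝ) :
    prodExp w (fun z => F (σ z)) = prodExp w F := by
  rw [prodExp, prodExp, ← Equiv.sum_comp hσ.toPerm]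
  refine Finset.sum_congr rfl fun z _ => ?_
  simp only [Function.Involutive.coe_toPerm, hw, hσ z]

lemma prodExp_swapAt (k : Fin m) (F : (Fin m → S × S) → ℝ) :
    prodExp (pairWeight q) (fun z => F (swapAt k z)) = prodExp (pairWeight q) F := by
  refine prodExp_comp_involutive (fun z => ?_) (fun z i => ?_) F
  · simp [swapAt]
  · rcases eq_or_ne i k with rfl | h
    · simp [swapAt, pairWeight, mul_comm]
    · simp [swapAt, h]

lemma prodExp_swapBelow (j : ℕ) (F : (Fin m → S × S) → ℝ) :
    prodExp (pairWeight q) (fun z => F (swapBelow j z)) = prodExp (pairWeight q) F := by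
  refine prodExp_comp_involutive (fun z => ?_) (fun z i => ?_) F
  · funext i
    simp only [swapBelow]
    split_ifs <;> simp
  · simp only [swapBelow]
    split_ifs <;> simp [pairWeight, mul_comm]

/-- The two component vectors are independent, each with the original product law. -/
lemma prodExp_pair_mul (F G : (Fin m → S) → ℝ) :
    prodExp (pairWeight q) (fun z => F (fstVec z) * G (mix m z)) = prodExp q F * prodExp q G := by
  rw [prodExp, prodExp, prodExp, Finset.sum_mul_sum, ← Fintype.sum_prod_type',
    ← Equiv.sum_comp (Equiv.arrowProdEquivProdArrow (Fin m) (fun _ => S) (fun _ => S)).symm]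
  refine Finset.sum_congr rfl fun a _ => ?_
  simp only [pairWeight, Finset.prod_mul_distrib]
  have h1 : fstVec ((Equiv.arrowProdEquivProdArrow (Fin m) (fun _ => S) (fun _ => S)).symm a)
      = a.1 := rfl
  have h2 : mix m ((Equiv.arrowProdEquivProdArrow (Fin m) (fun _ => S) (fun _ => S)).symm a)
      = a.2 := by
    funext i
    simp [mix]
  rw [h1, h2]
  simp only [Equiv.arrowProdEquivProdArrow_symm_apply]
  ring

lemma prodExp_fstVec (hq : IsWeight q) (F : (Fin m → S) → ℝ) :
    prodExp (pairWeight q) (fun z => F (fstVec z)) = prodExp q F := by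
  have := prodExp_pair_mul (q := q) F (fun _ => 1)
  simpa only [mul_one, prodExp_const hq] using this

/-- A covariance is a sum over coordinates of products of increments: telescope `F(x) - F(y)` for
an independent copy `y`, one coordinate at a time, and exchange the two values of that
coordinate. -/
lemma prodExp_mul_sub_eq (hq : IsWeight q) (F G : (Fin m → S) → ℝ) :
    prodExp q (fun x => F x * G x) - prodExp q F * prodExp q G
      = 1 / 2 * ∑ k, prodExp (pairWeight q) (fun z => mixIncr F k z * incr G k z) := by
  have tele : ∀ z : Fin m → S × S, ∑ k, mixIncr F k z = F (fstVec z) - F (mix m z) := by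
    intro z
    have := Finset.sum_range_sub' (fun j => F (mix j z)) m
    rw [Finset.sum_range] at this
    rw [← mix_zero, ← this]
    rfl
  have h1 : prodExp q (fun x => F x * G x) - prodExp q F * prodExp q G
      = ∑ k, prodExp (pairWeight q) (fun z => mixIncr F k z * G (fstVec z)) := by
    rw [← prodExp_sum, ← prodExp_fstVec hq, mul_comm (prodExp q F), ← prodExp_pair_mul,
      ← prodExp_sub]
    congr 1
    funext z
    rw [← Finset.sum_mul, tele]
    ring
  have h2 : ∀ k, prodExp (pairWeight q) (fun z => mixIncr F k z * incr G k z)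
      = 2 * prodExp (pairWeight q) (fun z => mixIncr F k z * G (fstVec z)) := by
    intro k
    have h3 := prodExp_swapAt (q := q) k (fun z => mixIncr F k z * G (fstVec z))
    simp only [mixIncr_swapAt, fstVec_swapAt] at h3
    rw [two_mul]
    nth_rewrite 1 [← h3]
    rw [← prodExp_add]
    congr 1
    funext z
    rw [incr]
    ring
  rw [h1, Finset.sum_congr rfl fun k _ => h2 k, ← Finset.mul_sum]
  ring

/-- The **Efron–Stein inequality**. -/
lemma variance_le_sum_incr_sq (hq : IsWeight q) (F : (Fin m → S) → ℝ) :
    prodExp q (fun x => (F x - prodExp q F) ^ 2)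
      ≤ 1 / 2 * ∑ k, prodExp (pairWeight q) (fun z => incr F k z ^ 2) := by
  have h := prodExp_mul_sub_eq hq F F
  have h0 : prodExp q (fun x => F x * F x) = prodExp q (fun x => F x ^ 2) := by
    simp only [sq]
  have h1 : prodExp q (fun x => (F x - prodExp q F) ^ 2)
      = 1 / 2 * ∑ k, prodExp (pairWeight q) (fun z => mixIncr F k z * incr F k z) := by
    rw [prodExp_sub_sq hq, ← h, h0]
    ring
  rw [h1]
  gcongr with k
  have h2 : prodExp (pairWeight q) (fun z => mixIncr F k z ^ 2)
      = prodExp (pairWeight q) (fun z => incr F k z ^ 2) := by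
    rw [← prodExp_swapBelow k.val (fun z => incr F k z ^ 2)]
    simp only [incr_swapBelow]
  calc prodExp (pairWeight q) (fun z => mixIncr F k z * incr F k z)
      ≤ prodExp (pairWeight q)
          (fun z => 1 / 2 * mixIncr F k z ^ 2 + 1 / 2 * incr F k z ^ 2) :=
        prodExp_mono hq.pairWeight fun z => by nlinarith [sq_nonneg (mixIncr F k z - incr F k z)]
    _ = _ := by
        rw [prodExp_add, prodExp_const_mul, prodExp_const_mul, h2]
        ring

end Exchange

/-! ### The number of related coordinates -/

section Influence

variable {S : Type*} [Fintype S] {m : ℕ} {q : S → ℝ}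

open Classical in
/-- The number of coordinates that are equal to `l` or have a value related to that of `l`. -/
noncomputable def numTouch (touch : S → S → Prop) (l : Fin m) (z : Fin m → S) : ℝ :=
  ∑ k, if k = l ∨ touch (z k) (z l) then 1 else 0

open Classical in
lemma prodExp_numTouch_sq_le (hq : IsWeight q) (touch : S → S → Prop) {c : ℝ}
    (hc : ∀ t, ∑ s, (if touch s t then q s else 0) ≤ c) (l : Fin m) :
    prodExp q (fun z => numTouch touch l z ^ 2) ≤ 1 + 3 * (m * c) + (m * c) ^ 2 := by
  set I : Fin m → (Fin m → S) → ℝ := fun k z => if k ≠ l ∧ touch (z k) (z l) then 1 else 0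
    with hI
  have hc0 : 0 ≤ c := by
    have hS : Nonempty S := by
      by_contra h
      rw [not_nonempty_iff] at h
      simpa using hq.2
    exact (Finset.sum_nonneg fun s _ => by split_ifs <;> simp [hq.1 s]).trans
      (hc (Classical.arbitrary S))
  have hI0 : ∀ k z, 0 ≤ I k z := fun k z => by simp only [hI]; split_ifs <;> norm_num
  have hII : ∀ k z, I k z * I k z = I k z := fun k z => by simp only [hI]; split_ifs <;> norm_num
  -- conditionally on the other coordinates, coordinate `k` is related to `z l` with
  -- probability at most `c`
  have step : ∀ (k : Fin m) (G : (Fin m → S) → ℝ), (∀ z, 0 ≤ G z) →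
      (∀ z s, k ≠ l → G (Function.update z k s) = G z) →
      prodExp q (fun z => G z * I k z) ≤ c * prodExp q G := by
    intro k G hG0 hG
    rcases eq_or_ne k l with rfl | hk
    · simp only [hI, ne_eq, not_true_eq_false, false_and, if_false, mul_zero, prodExp_const hq]
      exact mul_nonneg hc0 (prodExp_nonneg hq hG0)
    rw [prodExp_resample hq k, ← prodExp_const_mul]
    refine prodExp_mono hq fun z => ?_
    calc ∑ s, q s * (G (Function.update z k s) * I k (Function.update z k s))
        = G z * ∑ s, (if touch s (z l) then q s else 0) := by
          rw [Finset.mul_sum]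
          refine Finset.sum_congr rfl fun s _ => ?_
          rw [hG z s hk]
          simp only [hI, Function.update_self, Function.update_of_ne hk.symm, ne_eq, hk,
            not_false_eq_true, true_and]
          split_ifs <;> ring
      _ ≤ G z * c := mul_le_mul_of_nonneg_left (hc _) (hG0 z)
      _ = c * G z := mul_comm _ _
  have h1 : ∀ k, prodExp q (I k) ≤ c := by
    intro k
    have := step k (fun _ => 1) (fun _ => zero_le_one) (fun _ _ _ => rfl)
    simpa only [one_mul, prodExp_const hq, mul_one] using this
  have h2 : ∀ k k', prodExp q (fun z => I k z * I k' z) ≤ c ^ 2 + if k = k' then c else 0 := by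
    intro k k'
    rcases eq_or_ne k k' with rfl | hk
    · simp only [hII, if_true]
      nlinarith [h1 k]
    · have := step k' (I k) (hI0 k) (fun z s hk' => by
        simp only [hI, Function.update_of_ne hk, Function.update_of_ne hk'.symm])
      rw [if_neg hk]
      nlinarith [h1 k]
  have hN : ∀ z, numTouch touch l z = 1 + ∑ k, I k z := by
    intro z
    have : (1 : ℝ) = ∑ k, if k = l then 1 else 0 := by simp
    rw [this, ← Finset.sum_add_distrib]
    refine Finset.sum_congr rfl fun k _ => ?_
    simp only [hI]
    by_cases hk : k = l <;> simp [hk]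
  have hN2 : ∀ z, numTouch touch l z ^ 2 = 1 + 2 * ∑ k, I k z + ∑ k, ∑ k', I k z * I k' z := by
    intro z
    rw [hN, ← Finset.sum_mul_sum]
    ring
  simp only [hN2]
  rw [prodExp_add, prodExp_add, prodExp_const hq, prodExp_const_mul, prodExp_sum, prodExp_sum]
  have e1 : ∑ k, prodExp q (I k) ≤ m * c :=
    (Finset.sum_le_sum fun k _ => h1 k).trans (by simp)
  have e2 : ∑ k, prodExp q (fun z => ∑ k', I k z * I k' z) ≤ (m * c) ^ 2 + m * c := by
    refine (Finset.sum_le_sum (g := fun k : Fin m => m * c ^ 2 + c) fun k _ => ?_).trans ?_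
    · rw [prodExp_sum]
      refine (Finset.sum_le_sum fun k' _ => h2 k k').trans ?_
      simp [Finset.sum_add_distrib]
    · simp
      nlinarith
  linarith

end Influence

/-! ### Stein's method by exchange of coordinates -/

section Stein

variable {S : Type*} {m : ℕ}

/-- Half the sum of the products of increments; its mean is the variance of `W`. -/
noncomputable def incrProd (W : (Fin m → S) → ℝ) (z : Fin m → S × S) : ℝ :=
  1 / 2 * ∑ k, mixIncr W k z * incr W k z

/-- The variant of `incrProd` with one factor replaced by its absolute value; it is a sum of
terms that are antisymmetric under an exchange, so its mean is zero. -/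
def absIncrProd (W : (Fin m → S) → ℝ) (z : Fin m → S × S) : ℝ :=
  ∑ k, |mixIncr W k z| * incr W k z

variable [Fintype S] {q : S → ℝ}

lemma prodExp_incrProd (hq : IsWeight q) {W : (Fin m → S) → ℝ} (h0 : prodExp q W = 0)
    (h1 : prodExp q (fun y => W y ^ 2) = 1) : prodExp (pairWeight q) (incrProd W) = 1 := by
  have h := prodExp_mul_sub_eq hq W W
  simp only [← sq, h0, h1] at h
  rw [← prodExp_sum, ← prodExp_const_mul] at h
  change 1 - 0 ^ 2 = prodExp (pairWeight q) (incrProd W) at h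
  linarith

lemma prodExp_absIncrProd (W : (Fin m → S) → ℝ) :
    prodExp (pairWeight q) (absIncrProd W) = 0 := by
  change prodExp _ (fun z => ∑ k, |mixIncr W k z| * incr W k z) = 0
  rw [prodExp_sum]
  refine Finset.sum_eq_zero fun k _ => ?_
  have h := prodExp_swapAt (q := q) k (fun z => |mixIncr W k z| * incr W k z)
  simp only [mixIncr_swapAt, incr_swapAt, abs_neg, mul_neg, prodExp_neg] at h
  linarith

/-- By exchangeability, the weighted sum of increments of `g ∘ W` is controlled by `absIncrProd`,
with no absolute moment of third order. -/
lemma sum_prodExp_abs_mixIncr_mul (W : (Fin m → S) → ℝ) (g : ℝ → ℝ) :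
    ∑ k, prodExp (pairWeight q) (fun z => |mixIncr W k z| * incr W k z *
      (g (W (fstVec z)) - g (W (replaceAt k z))))
      = 2 * prodExp (pairWeight q) (fun z => absIncrProd W z * g (W (fstVec z))) := by
  have h : ∀ k, prodExp (pairWeight q) (fun z => |mixIncr W k z| * incr W k z *
      (g (W (fstVec z)) - g (W (replaceAt k z))))
      = 2 * prodExp (pairWeight q) (fun z => |mixIncr W k z| * incr W k z * g (W (fstVec z))) := by
    intro k
    have h := prodExp_swapAt (q := q) k
      (fun z => |mixIncr W k z| * incr W k z * g (W (fstVec z)))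
    simp only [mixIncr_swapAt, incr_swapAt, abs_neg, mul_neg, neg_mul, fstVec_swapAt,
      prodExp_neg] at h
    simp only [mul_sub]
    rw [prodExp_sub]
    linarith
  rw [Finset.sum_congr rfl fun k _ => h k, ← Finset.mul_sum, ← prodExp_sum]
  simp only [← Finset.sum_mul]
  rfl

/-- Normal approximation of a centred function of independent variables. The remainder of the
first-order expansion is dominated by increments of a bounded increasing function `g`, to which
`sum_prodExp_abs_mixIncr_mul` applies. -/
lemma abs_prodExp_stepFun_sub_normalCdf_le (hq : IsWeight q) {W : (Fin m → S) → ℝ}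
    (h0 : prodExp q W = 0) (x : ℝ) :
    |prodExp q (fun y => stepFun x (W y)) - normalCdf x| ≤
      2 * prodExp (pairWeight q) (fun z => |incrProd W z - 1|)
        + 2 * prodExp (pairWeight q) (fun z => |absIncrProd W z|) := by
  set f := steinSol x with hf
  set g : ℝ → ℝ := fun w => w * f w - stepFun x w with hg
  have hg2 : ∀ w, |g w| ≤ 2 := by
    intro w
    have h1 := abs_le.1 (abs_mul_steinSol_le_one x w)
    have h2 := stepFun_mem x w
    rw [abs_le]
    constructor <;> simp only [hg, hf] <;> linarith [h1.1, h1.2, h2.1, h2.2]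
  -- the error of the first-order expansion of `f (W (replaceAt k z))` at `W (fstVec z)`
  set ρ : Fin m → (Fin m → S × S) → ℝ := fun k z =>
    f (W (replaceAt k z)) - f (W (fstVec z))
      - (W (replaceAt k z) - W (fstVec z)) * steinDeriv x (W (fstVec z))
    with hρ
  have hρ_le : ∀ k z, |mixIncr W k z * ρ k z| ≤
      |mixIncr W k z| * incr W k z * (g (W (fstVec z)) - g (W (replaceAt k z))) := by
    intro k z
    rw [abs_mul, mul_assoc]
    refine mul_le_mul_of_nonneg_left ?_ (abs_nonneg _)
    refine (abs_steinSol_sub_sub_le x (W (fstVec z)) (W (replaceAt k z))).trans (le_of_eq ?_)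
    simp only [incr, hg, ← hf]
    rcases le_total (W (fstVec z)) (W (replaceAt k z)) with h | h
    · have h1 := monotone_mul_steinSol x h
      have h2 := antitone_stepFun x h
      simp only [← hf] at h1
      rw [abs_of_nonneg (sub_nonneg.2 h), abs_of_nonneg (sub_nonneg.2 h1),
        abs_of_nonpos (sub_nonpos.2 h2)]
      ring
    · have h1 := monotone_mul_steinSol x h
      have h2 := antitone_stepFun x h
      simp only [← hf] at h1
      rw [abs_of_nonpos (sub_nonpos.2 h), abs_of_nonpos (sub_nonpos.2 h1),
        abs_of_nonneg (sub_nonneg.2 h2)]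
      ring
  have hmain : prodExp q (fun y => stepFun x (W y)) - normalCdf x
      = prodExp (pairWeight q) (fun z => steinDeriv x (W (fstVec z)) * (1 - incrProd W z)
        + 1 / 2 * ∑ k, mixIncr W k z * ρ k z) := by
    have h1 : prodExp q (fun y => W y * f (W y))
        = prodExp (pairWeight q) (fun z => 1 / 2 * ∑ k, mixIncr W k z * incr (f ∘ W) k z) := by
      rw [prodExp_const_mul, prodExp_sum, ← prodExp_mul_sub_eq hq, h0, zero_mul, sub_zero]
      rfl
    have h2 : prodExp q (fun y => stepFun x (W y)) - normalCdf x
        = prodExp (pairWeight q) (fun z => steinDeriv x (W (fstVec z)))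
          - prodExp q (fun y => W y * f (W y)) := by
      rw [prodExp_fstVec hq (fun y => steinDeriv x (W y)), ← prodExp_sub,
        ← prodExp_const (m := m) hq (normalCdf x), ← prodExp_sub]
      congr 1
      funext y
      simp only [steinDeriv]
      ring
    rw [h2, h1, ← prodExp_sub]
    congr 1
    funext z
    have h3 : ∀ k, mixIncr W k z * incr (f ∘ W) k z
        = mixIncr W k z * incr W k z * steinDeriv x (W (fstVec z)) - mixIncr W k z * ρ k z := by
      intro k
      simp only [incr, Function.comp, hρ]
      ring
    rw [Finset.sum_congr rfl fun k _ => h3 k, Finset.sum_sub_distrib, ← Finset.sum_mul, incrProd]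
    ring
  have hR : prodExp (pairWeight q) (fun z => 1 / 2 * ∑ k, |mixIncr W k z * ρ k z|)
      ≤ 2 * prodExp (pairWeight q) (fun z => |absIncrProd W z|) := by
    rw [prodExp_const_mul, prodExp_sum]
    calc _ ≤ 1 / 2 * ∑ k, prodExp (pairWeight q) (fun z => |mixIncr W k z| * incr W k z *
            (g (W (fstVec z)) - g (W (replaceAt k z)))) := by
          gcongr with k
          exact prodExp_mono hq.pairWeight (hρ_le k)
      _ = prodExp (pairWeight q) (fun z => absIncrProd W z * g (W (fstVec z))) := by
          rw [sum_prodExp_abs_mixIncr_mul]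
          ring
      _ ≤ prodExp (pairWeight q) (fun z => 2 * |absIncrProd W z|) := by
          refine prodExp_mono hq.pairWeight fun z => (le_abs_self _).trans ?_
          rw [abs_mul, mul_comm]
          exact mul_le_mul_of_nonneg_right (hg2 _) (abs_nonneg _)
      _ = _ := prodExp_const_mul _ _
  rw [hmain]
  refine (abs_prodExp_le hq.pairWeight _).trans ?_
  refine le_trans (b := prodExp (pairWeight q) (fun z => 2 * |incrProd W z - 1|
    + 1 / 2 * ∑ k, |mixIncr W k z * ρ k z|)) (prodExp_mono hq.pairWeight fun z => ?_) ?_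
  · refine (abs_add_le _ _).trans (add_le_add ?_ ?_)
    · rw [abs_mul, abs_sub_comm]
      exact mul_le_mul_of_nonneg_right (abs_steinDeriv_le_two _ _) (abs_nonneg _)
    · rw [abs_mul, abs_of_pos (by norm_num : (0 : ℝ) < 1 / 2)]
      gcongr
      exact Finset.abs_sum_le_sum_abs _ _
  · rw [prodExp_add, prodExp_const_mul]
    gcongr

end Stein

/-! ### Functions with local increments -/

section Local

variable {A : Type*} [Fintype A] {m : ℕ}

/-- Some value of the pair `s.1` occurs among the four values of `t`. -/
def Touch (s t : (A × A) × (A × A)) : Prop :=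
  (s.1.1 = t.1.1 ∨ s.1.1 = t.1.2 ∨ s.1.1 = t.2.1 ∨ s.1.1 = t.2.2) ∨
    (s.1.2 = t.1.1 ∨ s.1.2 = t.1.2 ∨ s.1.2 = t.2.1 ∨ s.1.2 = t.2.2)

open Classical in
lemma sum_touch_le {p : A → ℝ} (hp : IsWeight p) {b : ℝ} (hb : ∀ a, p a ≤ b)
    (t : (A × A) × (A × A)) :
    ∑ s, (if Touch s t then pairWeight (pairWeight p) s else 0) ≤ 8 * b := by
  have h1 : ∀ v, ∑ s : (A × A) × (A × A),
      (if s.1.1 = v then pairWeight (pairWeight p) s else 0) = p v := by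
    intro v
    simp only [pairWeight, Fintype.sum_prod_type]
    have : ∀ x : A, (∑ y, ∑ z, ∑ w, if x = v then p x * p y * (p z * p w) else 0)
        = if x = v then p x else 0 := by
      intro x
      split_ifs
      · simp only [← Finset.mul_sum, hp.2, mul_one]
      · simp
    simp only [this, Finset.sum_ite_eq', Finset.mem_univ, if_true]
  have h2 : ∀ v, ∑ s : (A × A) × (A × A),
      (if s.1.2 = v then pairWeight (pairWeight p) s else 0) = p v := by
    intro v
    simp only [pairWeight, Fintype.sum_prod_type]
    have : ∀ x y : A, (∑ z, ∑ w, if y = v then p x * p y * (p z * p w) else 0)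
        = if y = v then p x * p y else 0 := by
      intro x y
      split_ifs
      · simp only [← Finset.mul_sum, hp.2, mul_one]
      · simp
    simp only [this, Finset.sum_ite_eq', Finset.mem_univ, if_true, ← Finset.sum_mul, hp.2, one_mul]
  calc _ ≤ ∑ s, (((if s.1.1 = t.1.1 then pairWeight (pairWeight p) s else 0)
          + (if s.1.1 = t.1.2 then pairWeight (pairWeight p) s else 0)
          + (if s.1.1 = t.2.1 then pairWeight (pairWeight p) s else 0)
          + (if s.1.1 = t.2.2 then pairWeight (pairWeight p) s else 0))
        + ((if s.1.2 = t.1.1 then pairWeight (pairWeight p) s else 0)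
          + (if s.1.2 = t.1.2 then pairWeight (pairWeight p) s else 0)
          + (if s.1.2 = t.2.1 then pairWeight (pairWeight p) s else 0)
          + (if s.1.2 = t.2.2 then pairWeight (pairWeight p) s else 0))) := by
        refine Finset.sum_le_sum fun s _ => ?_
        have hw := hp.pairWeight.pairWeight.1 s
        have hn : ∀ P : Prop, 0 ≤ if P then pairWeight (pairWeight p) s else 0 := fun P => by
          split_ifs
          exacts [hw, le_rfl]
        by_cases h : Touch s t
        · rw [if_pos h]
          have e1 := hn (s.1.1 = t.1.1)
          have e2 := hn (s.1.1 = t.1.2)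
          have e3 := hn (s.1.1 = t.2.1)
          have e4 := hn (s.1.1 = t.2.2)
          have e5 := hn (s.1.2 = t.1.1)
          have e6 := hn (s.1.2 = t.1.2)
          have e7 := hn (s.1.2 = t.2.1)
          have e8 := hn (s.1.2 = t.2.2)
          rcases h with (h | h | h | h) | (h | h | h | h) <;> rw [if_pos h] at * <;> linarith
        · rw [if_neg h]
          exact add_nonneg (add_nonneg (add_nonneg (add_nonneg (hn _) (hn _)) (hn _)) (hn _))
            (add_nonneg (add_nonneg (add_nonneg (hn _) (hn _)) (hn _)) (hn _))
    _ = 2 * (p t.1.1 + p t.1.2 + p t.2.1 + p t.2.2) := by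
        simp only [Finset.sum_add_distrib, h1, h2]
        ring
    _ ≤ 8 * b := by linarith [hb t.1.1, hb t.1.2, hb t.2.1, hb t.2.2]

open Classical in
/-- Mean absolute deviation of a sum of bounded terms, one for each coordinate, such that resampling
coordinate `l` affects only the terms of the coordinates counted by `numTouch`. -/
lemma prodExp_abs_sub_le {p : A → ℝ} (hp : IsWeight p) {b : ℝ} (hb : ∀ a, p a ≤ b)
    (τ : Fin m → (Fin m → A × A) → ℝ) {β : ℝ} (hβ : ∀ k z, |τ k z| ≤ β)
    (hτ : ∀ k l (y : Fin m → (A × A) × (A × A)), k ≠ l → ¬ Touch (y k) (y l) →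
      τ k (replaceAt l y) = τ k (fstVec y)) :
    prodExp (pairWeight p) (fun z => |∑ k, τ k z - prodExp (pairWeight p) fun z => ∑ k, τ k z|)
      ≤ 2 * β * √m * (1 + 12 * (m * b)) := by
  rcases Nat.eq_zero_or_pos m with rfl | hm
  · simp [prodExp_const hp.pairWeight]
  have hβ0 : 0 ≤ β := by
    have hA : Nonempty A := by
      by_contra h
      rw [not_nonempty_iff] at h
      simpa using hp.2
    exact (abs_nonneg _).trans (hβ ⟨0, hm⟩ fun _ => Classical.arbitrary _)
  have hb0 : 0 ≤ b := by
    have hA : Nonempty A := by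
      by_contra h
      rw [not_nonempty_iff] at h
      simpa using hp.2
    exact (hp.1 _).trans (hb (Classical.arbitrary A))
  refine (prodExp_abs_le_sqrt hp.pairWeight _).trans (Real.sqrt_le_iff.2 ⟨by positivity, ?_⟩)
  refine (variance_le_sum_incr_sq hp.pairWeight _).trans ?_
  have hinc : ∀ l (y : Fin m → (A × A) × (A × A)),
      |incr (fun z => ∑ k, τ k z) l y| ≤ 2 * β * numTouch Touch l y := by
    intro l y
    rw [incr, ← Finset.sum_sub_distrib, numTouch, Finset.mul_sum]
    refine (Finset.abs_sum_le_sum_abs _ _).trans (Finset.sum_le_sum fun k _ => ?_)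
    split_ifs with h
    · have := abs_sub (τ k (fstVec y)) (τ k (replaceAt l y))
      linarith [hβ k (fstVec y), hβ k (replaceAt l y)]
    · rw [not_or] at h
      rw [hτ k l y h.1 h.2]
      simp
  have hl : ∀ l : Fin m, prodExp (pairWeight (pairWeight p))
      (fun y => incr (fun z => ∑ k, τ k z) l y ^ 2)
      ≤ (2 * β) ^ 2 * (1 + 3 * (m * (8 * b)) + (m * (8 * b)) ^ 2) := by
    intro l
    refine (prodExp_mono hp.pairWeight.pairWeight (G := fun y =>
      (2 * β) ^ 2 * numTouch Touch l y ^ 2) fun y => ?_).trans ?_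
    · rw [← mul_pow]
      exact sq_le_sq' (neg_le_of_abs_le (hinc l y)) (le_of_abs_le (hinc l y))
    · rw [prodExp_const_mul]
      gcongr
      exact prodExp_numTouch_sq_le hp.pairWeight.pairWeight Touch (sum_touch_le hp hb) l
  calc _ ≤ 1 / 2 * ∑ l : Fin m,
        (2 * β) ^ 2 * (1 + 3 * (m * (8 * b)) + (m * (8 * b)) ^ 2) := by
        gcongr with l
        exact hl l
    _ = 2 * β ^ 2 * m * (1 + 24 * (m * b) + 64 * (m * b) ^ 2) := by
        simp
        ring
    _ ≤ 4 * β ^ 2 * m * (1 + 24 * (m * b) + 144 * (m * b) ^ 2) := by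
        gcongr <;> norm_num
    _ = _ := by
        rw [mul_pow (2 * β * √m), mul_pow (2 * β) √m, Real.sq_sqrt (Nat.cast_nonneg m)]
        ring

/-- Normal approximation for a function of independent variables whose increments are bounded by
`α`, and whose increment in coordinate `k` is not affected by a change in another coordinate that
involves neither the old nor the new value of coordinate `k`. -/
lemma abs_prodExp_stepFun_sub_normalCdf_le_of_local {p : A → ℝ} (hp : IsWeight p) {b : ℝ}
    (hb : ∀ a, p a ≤ b) {W : (Fin m → A) → ℝ} (h0 : prodExp p W = 0)
    (h1 : prodExp p (fun y => W y ^ 2) = 1) {α : ℝ}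
    (hα : ∀ x k a, |W x - W (Function.update x k a)| ≤ α)
    (hloc : ∀ x k a l c, k ≠ l → c ≠ x k → c ≠ a → x l ≠ x k → x l ≠ a →
      W (Function.update x l c) - W (Function.update (Function.update x l c) k a)
        = W x - W (Function.update x k a)) (x : ℝ) :
    |prodExp p (fun y => stepFun x (W y)) - normalCdf x|
      ≤ 6 * α ^ 2 * √m * (1 + 12 * (m * b)) := by
  have hincr : ∀ k z, |incr W k z| ≤ α := fun k z => hα _ _ _
  have hmix : ∀ k z, |mixIncr W k z| ≤ α := fun k z => by
    rw [mixIncr, mix_succ]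
    exact hα _ _ _
  have hflip : ∀ k l (y : Fin m → (A × A) × (A × A)), k ≠ l → replaceAt l y k = fstVec y k :=
    fun k l y h => by rw [replaceAt, Function.update_of_ne h]
  have hleft : ∀ l (y : Fin m → (A × A) × (A × A)),
      fstVec (replaceAt l y) = Function.update (fstVec (fstVec y)) l (y l).2.1 := by
    intro l y
    funext i
    rcases eq_or_ne i l with rfl | h
    · simp [fstVec, replaceAt]
    · simp [fstVec, replaceAt, h]
  have hmixf : ∀ j l (y : Fin m → (A × A) × (A × A)), mix j (replaceAt l y)
      = Function.update (mix j (fstVec y)) l (if l.val < j then (y l).2.2 else (y l).2.1) := by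
    intro j l y
    funext i
    rcases eq_or_ne i l with rfl | h
    · simp [mix, replaceAt]
    · simp [mix, replaceAt, h]
  have hincr_loc : ∀ k l (y : Fin m → (A × A) × (A × A)), k ≠ l → ¬ Touch (y k) (y l) →
      incr W k (replaceAt l y) = incr W k (fstVec y) := by
    intro k l y hkl ht
    simp only [Touch, not_or] at ht
    have e : ∀ z, incr W k z = W (fstVec z) - W (Function.update (fstVec z) k (z k).2) :=
      fun _ => rfl
    rw [e, e, hleft, hflip k l y hkl]
    refine hloc _ k _ l _ hkl ?_ ?_ ?_ ?_ <;> simp only [fstVec]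
    · exact Ne.symm ht.1.2.2.1
    · exact Ne.symm ht.2.2.2.1
    · exact Ne.symm ht.1.1
    · exact Ne.symm ht.2.1
  have hmix_loc : ∀ k l (y : Fin m → (A × A) × (A × A)), k ≠ l → ¬ Touch (y k) (y l) →
      mixIncr W k (replaceAt l y) = mixIncr W k (fstVec y) := by
    intro k l y hkl ht
    simp only [Touch, not_or] at ht
    rw [mixIncr, mixIncr, mix_succ, mix_succ, hmixf, hflip k l y hkl]
    refine hloc _ k _ l _ hkl ?_ ?_ ?_ ?_ <;> simp only [fstVec, mix, lt_irrefl, if_false] <;>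
      split_ifs
    · exact Ne.symm ht.1.2.2.2
    · exact Ne.symm ht.1.2.2.1
    · exact Ne.symm ht.2.2.2.2
    · exact Ne.symm ht.2.2.2.1
    · exact Ne.symm ht.1.2.1
    · exact Ne.symm ht.1.1
    · exact Ne.symm ht.2.2.1
    · exact Ne.symm ht.2.1
  have hT := prodExp_abs_sub_le hp hb
    (fun k z => 1 / 2 * (mixIncr W k z * incr W k z)) (β := α ^ 2 / 2)
    (fun k z => by
      rw [abs_mul, abs_mul, abs_of_pos (by norm_num : (0 : ℝ) < 1 / 2)]
      have := mul_le_mul (hmix k z) (hincr k z) (abs_nonneg _) ((abs_nonneg _).trans (hmix k z))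
      linarith)
    (fun k l y hkl ht => by rw [hincr_loc k l y hkl ht, hmix_loc k l y hkl ht])
  have hR := prodExp_abs_sub_le hp hb
    (fun k z => |mixIncr W k z| * incr W k z) (β := α ^ 2)
    (fun k z => by
      rw [abs_mul, abs_abs]
      have := mul_le_mul (hmix k z) (hincr k z) (abs_nonneg _) ((abs_nonneg _).trans (hmix k z))
      linarith)
    (fun k l y hkl ht => by rw [hincr_loc k l y hkl ht, hmix_loc k l y hkl ht])
  simp only [← Finset.mul_sum] at hT
  have e1 := prodExp_incrProd hp h0 h1
  have e2 := prodExp_absIncrProd (q := p) W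
  change prodExp _ (fun z => |incrProd W z - prodExp _ (incrProd W)|) ≤ _ at hT
  change prodExp _ (fun z => |absIncrProd W z - prodExp _ (absIncrProd W)|) ≤ _ at hR
  rw [e1] at hT
  rw [e2] at hR
  simp only [sub_zero] at hR
  refine (abs_prodExp_stepFun_sub_normalCdf_le hp h0 x).trans ?_
  linarith

/-- The bound for weak inequalities follows from the one for strict inequalities by passing to
`-W`. -/
lemma abs_prodExp_indicator_le_sub_normalCdf_le_of_local {p : A → ℝ} (hp : IsWeight p) {b : ℝ}
    (hb : ∀ a, p a ≤ b) {W : (Fin m → A) → ℝ} (h0 : prodExp p W = 0)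
    (h1 : prodExp p (fun y => W y ^ 2) = 1) {α : ℝ}
    (hα : ∀ x k a, |W x - W (Function.update x k a)| ≤ α)
    (hloc : ∀ x k a l c, k ≠ l → c ≠ x k → c ≠ a → x l ≠ x k → x l ≠ a →
      W (Function.update x l c) - W (Function.update (Function.update x l c) k a)
        = W x - W (Function.update x k a)) (x : ℝ) :
    |prodExp p (fun y => if W y ≤ x then 1 else 0) - normalCdf x|
      ≤ 6 * α ^ 2 * √m * (1 + 12 * (m * b)) := by
  have h := abs_prodExp_stepFun_sub_normalCdf_le_of_local hp hb (W := fun y => -W y) (α := α)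
    (by rw [prodExp_neg, h0, neg_zero]) (by simpa only [neg_sq] using h1)
    (fun x k a => by
      rw [neg_sub_neg, abs_sub_comm]
      exact hα x k a)
    (fun x k a l c e1 e2 e3 e4 e5 => by
      have := hloc x k a l c e1 e2 e3 e4 e5
      linarith) (-x)
  have e : (fun y => stepFun (-x) (-W y)) = fun y => 1 - if W y ≤ x then (1 : ℝ) else 0 := by
    funext y
    simp only [stepFun, neg_lt_neg_iff]
    by_cases hy : W y ≤ x
    · simp [hy]
    · simp [hy, not_le.1 hy]
  rw [e, prodExp_sub, prodExp_const hp, normalCdf_neg, sub_sub_sub_cancel_left,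
    abs_sub_comm] at h
  exact h

end Local

/-! ### The occupancy statistic -/

section Configuration

variable {m n : ℕ}

/-- The statistic `∑ i, h_i(ξ_i)` as a function of the vector of the boxes of the balls. -/
def configStat (h : Fin n → ℕ → ℝ) : (Fin m → Fin n) → ℝ := statistic (fun k x => x k) h

/-- The number of balls in box `i`, as a function of the vector of the boxes of the balls. -/
def configCount (x : Fin m → Fin n) (i : Fin n) : ℕ :=
  boxCount (fun k (x : Fin m → Fin n) => x k) i x

lemma configStat_eq (h : Fin n → ℕ → ℝ) (x : Fin m → Fin n) :
    configStat h x = ∑ i, h i (configCount x i) := rfl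

lemma configCount_congr {x x' : Fin m → Fin n} {i : Fin n} (h : ∀ j, x j = i ↔ x' j = i) :
    configCount x i = configCount x' i := by
  simp only [configCount, boxCount, h]

lemma configCount_update_of_ne {x : Fin m → Fin n} {k : Fin m} {a i : Fin n} (h1 : x k ≠ i)
    (h2 : a ≠ i) : configCount (Function.update x k a) i = configCount x i := by
  refine configCount_congr fun j => ?_
  rcases eq_or_ne j k with rfl | hj
  · simp [h1, h2]
  · rw [Function.update_of_ne hj]

lemma configCount_update_self {x : Fin m → Fin n} {k : Fin m} {i : Fin n} (h : x k ≠ i) :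
    configCount (Function.update x k i) i = configCount x i + 1 := by
  have : (Finset.univ.filter fun j => Function.update x k i j = i)
      = insert k (Finset.univ.filter fun j => x j = i) := by
    ext j
    rcases eq_or_ne j k with rfl | hj
    · simp
    · simp [hj]
  rw [configCount, boxCount, this, Finset.card_insert_of_notMem (by simp [h])]
  rfl

lemma abs_configStat_sub_update_le {h : Fin n → ℕ → ℝ} {M : ℝ}
    (hM : ∀ i j, |h i (j + 1) - h i j| ≤ M) (x : Fin m → Fin n) (k : Fin m) (a : Fin n) :
    |configStat h x - configStat h (Function.update x k a)| ≤ 2 * M := by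
  have hM0 : 0 ≤ M := (abs_nonneg _).trans (hM a 0)
  rcases eq_or_ne (x k) a with rfl | ha
  · simpa using hM0
  rw [configStat_eq, configStat_eq, ← Finset.sum_sub_distrib]
  calc _ ≤ ∑ i, |h i (configCount x i) - h i (configCount (Function.update x k a) i)| :=
        Finset.abs_sum_le_sum_abs _ _
    _ ≤ ∑ i, ((if i = x k then M else 0) + if i = a then M else 0) := by
        refine Finset.sum_le_sum fun i _ => ?_
        rcases eq_or_ne i (x k) with rfl | h1
        · have e := configCount_update_self (x := Function.update x k a) (k := k) (i := x k)
            (by simpa using ha.symm)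
          rw [Function.update_idem, Function.update_eq_self] at e
          rw [e, if_pos rfl, if_neg ha, add_zero]
          exact hM _ _
        · rcases eq_or_ne i a with rfl | h2
          · rw [configCount_update_self ha, if_neg h1, if_pos rfl, zero_add, abs_sub_comm]
            exact hM _ _
          · rw [configCount_update_of_ne h1.symm h2.symm]
            simp [h1, h2]
    _ = 2 * M := by
        simp [Finset.sum_add_distrib]
        ring

lemma configStat_update_sub_update (h : Fin n → ℕ → ℝ) (x : Fin m → Fin n) (k : Fin m)
    (a : Fin n) (l : Fin m) (c : Fin n) (hkl : k ≠ l) (h1 : c ≠ x k) (h2 : c ≠ a)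
    (h3 : x l ≠ x k) (h4 : x l ≠ a) :
    configStat h (Function.update x l c)
        - configStat h (Function.update (Function.update x l c) k a)
      = configStat h x - configStat h (Function.update x k a) := by
  simp only [configStat_eq, ← Finset.sum_sub_distrib]
  refine Finset.sum_congr rfl fun i _ => ?_
  by_cases hi : i = x k ∨ i = a
  · have e1 : configCount (Function.update x l c) i = configCount x i := by
      rcases hi with rfl | rfl
      · exact configCount_update_of_ne h3 h1
      · exact configCount_update_of_ne h4 h2
    have e2 : configCount (Function.update (Function.update x l c) k a) i
        = configCount (Function.update x k a) i := by
      rw [Function.update_comm hkl.symm]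
      refine configCount_update_of_ne ?_ ?_
      · rw [Function.update_of_ne hkl.symm]
        rcases hi with rfl | rfl <;> assumption
      · rcases hi with rfl | rfl <;> assumption
    rw [e1, e2]
  · rw [not_or] at hi
    have e1 : configCount (Function.update (Function.update x l c) k a) i
        = configCount (Function.update x l c) i := by
      refine configCount_update_of_ne ?_ (Ne.symm hi.2)
      rw [Function.update_of_ne hkl]
      exact Ne.symm hi.1
    rw [e1, configCount_update_of_ne (Ne.symm hi.1) (Ne.symm hi.2), sub_self, sub_self]

end Configuration

section Law

variable {Ω : Type*} [MeasurableSpace Ω] {P : Measure Ω} {m n : ℕ}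
  {p : Fin n → ℝ} {X : Fin m → Ω → Fin n}

lemma IsOccupancyScheme.measurable_config (hX : IsOccupancyScheme P p X) :
    Measurable fun ω k => X k ω := measurable_pi_lambda _ hX.measurable

lemma IsOccupancyScheme.measurable_statistic (hX : IsOccupancyScheme P p X)
    (h : Fin n → ℕ → ℝ) : Measurable (statistic X h) :=
  (measurable_of_finite (configStat h)).comp hX.measurable_config

lemma IsOccupancyScheme.measurable_standardize (hX : IsOccupancyScheme P p X)
    (h : Fin n → ℕ → ℝ) : Measurable (standardize P (statistic X h)) :=
  ((hX.measurable_statistic h).sub_const _).div_const _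

lemma le_maxProb (p : Fin n → ℝ) (i : Fin n) : p i ≤ maxProb p :=
  le_ciSup (Set.finite_range p).bddAbove i

variable [IsProbabilityMeasure P]

lemma IsOccupancyScheme.integral_comp (hX : IsOccupancyScheme P p X)
    (F : (Fin m → Fin n) → ℝ) : ∫ ω, F (fun k => X k ω) ∂P = prodExp p F := by
  have hm := hX.measurable_config
  have : IsProbabilityMeasure (P.map fun ω k => X k ω) :=
    Measure.isProbabilityMeasure_map hm.aemeasurable
  rw [← integral_map (φ := fun ω k => X k ω) (f := F) hm.aemeasurable
    (measurable_of_finite F).aestronglyMeasurable, integral_fintype .of_finite, prodExp]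
  refine Finset.sum_congr rfl fun x _ => ?_
  rw [smul_eq_mul, hX.indep.map_fun_eq_pi_map fun k => (hX.measurable k).aemeasurable]
  congr 1
  rw [measureReal_def, Measure.pi_singleton, ENNReal.toReal_prod]
  refine Finset.prod_congr rfl fun k _ => ?_
  rw [Measure.map_apply (hX.measurable k) (measurableSet_singleton _), ← hX.prob_eq k (x k)]
  rfl

/-- The Kolmogorov distance in the central limit theorem is at most a multiple of
`√m (1 + m p̄) ‖Δh‖² / σ²`. -/
theorem kolmogorovDist_standardize_le (hp : IsProbVector p) (hX : IsOccupancyScheme P p X)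
    {h : Fin n → ℕ → ℝ} {M : ℝ} (hM : ∀ i j, |h i (j + 1) - h i j| ≤ M)
    (hσ : 0 < variance (statistic X h) P) :
    kolmogorovDist (P.map (standardize P (statistic X h))) (gaussianReal 0 1)
      ≤ 24 * M ^ 2 * √m * (1 + 12 * (m * maxProb p)) / variance (statistic X h) P := by
  set v := variance (statistic X h) P with hv
  set μ := ∫ ω, statistic X h ω ∂P with hμ
  set W : (Fin m → Fin n) → ℝ := fun x => (configStat h x - μ) / √v with hW
  have hw : IsWeight p := hp
  have hσ' : 0 < √v := Real.sqrt_pos.2 hσ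
  have hμ' : μ = prodExp p (configStat h) := hX.integral_comp (configStat h)
  have hv' : v = prodExp p fun x : Fin m → Fin n => (configStat h x - μ) ^ 2 := by
    rw [hv, variance_eq_integral (hX.measurable_statistic h).aemeasurable]
    exact hX.integral_comp fun x => (configStat h x - μ) ^ 2
  have hWc : W = fun x => (√v)⁻¹ * (configStat h x - μ) := by
    funext x
    simp only [hW, div_eq_inv_mul]
  have hW0 : prodExp p W = 0 := by
    rw [hWc, prodExp_const_mul, prodExp_sub, prodExp_const hw, ← hμ', sub_self, mul_zero]
  have hW1 : prodExp p (fun x => W x ^ 2) = 1 := by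
    have : (fun x => W x ^ 2) = fun x => v⁻¹ * (configStat h x - μ) ^ 2 := by
      funext x
      rw [hWc, mul_pow, inv_pow, Real.sq_sqrt hσ.le]
    rw [this, prodExp_const_mul, ← hv', inv_mul_cancel₀ hσ.ne']
  have hdiff : ∀ x y, W x - W y = (configStat h x - configStat h y) / √v := fun x y => by
    simp only [hW]
    ring
  have hα : ∀ x k a, |W x - W (Function.update x k a)| ≤ 2 * M / √v := fun x k a => by
    rw [hdiff, abs_div, abs_of_pos hσ']
    exact div_le_div_of_nonneg_right (abs_configStat_sub_update_le hM x k a) hσ'.le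
  refine ciSup_le fun x => ?_
  have hcdf : (P.map (standardize P (statistic X h))).real (Set.Iic x)
      = prodExp p fun y => if W y ≤ x then 1 else 0 := by
    rw [map_measureReal_apply (hX.measurable_standardize h) measurableSet_Iic,
      ← hX.integral_comp fun y => if W y ≤ x then 1 else 0, ← integral_indicator_one
      (hX.measurable_standardize h measurableSet_Iic)]
    rfl
  have hmain := abs_prodExp_indicator_le_sub_normalCdf_le_of_local hw (le_maxProb p) hW0 hW1 hα
    (fun x k a l c e1 e2 e3 e4 e5 => by
      rw [hdiff, hdiff, configStat_update_sub_update h x k a l c e1 e2 e3 e4 e5]) x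
  rw [hcdf]
  refine hmain.trans (le_of_eq ?_)
  rw [div_pow, Real.sq_sqrt hσ.le]
  ring

end Law

/-! ### Kolmogorov distance and weak convergence -/

lemma abs_measureReal_Iic_sub_le_kolmogorovDist (P Q : Measure ℝ) [IsProbabilityMeasure P]
    [IsProbabilityMeasure Q] (x : ℝ) :
    |P.real (Set.Iic x) - Q.real (Set.Iic x)| ≤ kolmogorovDist P Q := by
  refine le_ciSup (f := fun x => |P.real (Set.Iic x) - Q.real (Set.Iic x)|) ⟨1, ?_⟩ x
  rintro _ ⟨y, rfl⟩
  have h1 : P.real (Set.Iic y) ≤ 1 := measureReal_le_one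
  have h2 : Q.real (Set.Iic y) ≤ 1 := measureReal_le_one
  have h3 : 0 ≤ P.real (Set.Iic y) := measureReal_nonneg
  have h4 : 0 ≤ Q.real (Set.Iic y) := measureReal_nonneg
  exact abs_le.2 ⟨by linarith, by linarith⟩

/-- Convergence in Kolmogorov distance implies weak convergence. -/
lemma tendsto_of_tendsto_kolmogorovDist {ι : Type*} {l : Filter ι} [l.IsCountablyGenerated]
    {μ : ι → ProbabilityMeasure ℝ} {ν : ProbabilityMeasure ℝ}
    (h : Tendsto (fun k => kolmogorovDist (μ k) ν) l (𝓝 0)) : Tendsto μ l (𝓝 ν) := by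
  have hcdf : ∀ x, Tendsto (fun k => (μ k : Measure ℝ).real (Set.Iic x)) l
      (𝓝 ((ν : Measure ℝ).real (Set.Iic x))) := by
    intro x
    rw [tendsto_iff_dist_tendsto_zero]
    exact squeeze_zero (fun _ => dist_nonneg)
      (fun k => abs_measureReal_Iic_sub_le_kolmogorovDist (μ k : Measure ℝ) ν x) h
  have hIoc : ∀ (ρ : ProbabilityMeasure ℝ) (a b : ℝ), a < b → (ρ : Measure ℝ).real (Set.Ioc a b)
      = (ρ : Measure ℝ).real (Set.Iic b) - (ρ : Measure ℝ).real (Set.Iic a) := by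
    intro ρ a b hab
    rw [← Set.Iic_sdiff_Iic]
    exact measureReal_sdiff (Set.Iic_subset_Iic.2 hab.le) measurableSet_Iic
  refine (isPiSystem_Ioc (id : ℝ → ℝ) (id : ℝ → ℝ)).tendsto_probabilityMeasure_of_tendsto_of_mem
    ?_ ?_ ?_
  · rintro _ ⟨a, b, -, rfl⟩
    exact measurableSet_Ioc
  · intro u hu x hx
    obtain ⟨ε, hε, hball⟩ := Metric.isOpen_iff.1 hu x hx
    refine ⟨Set.Ioc (x - ε / 2) (x + ε / 2), ⟨_, _, by simp only [id]; linarith, rfl⟩,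
      Ioc_mem_nhds (by linarith) (by linarith), fun y hy => hball ?_⟩
    rw [Metric.mem_ball, Real.dist_eq, abs_lt]
    constructor <;> linarith [hy.1, hy.2]
  · rintro _ ⟨a, b, hab, rfl⟩
    rw [← NNReal.tendsto_coe]
    change Tendsto (fun k => (μ k : Measure ℝ).real (Set.Ioc a b)) l
      (𝓝 ((ν : Measure ℝ).real (Set.Ioc a b)))
    simp only [hIoc _ a b hab]
    exact (hcdf b).sub (hcdf a)

/-! ### The central limit theorem for occupancy statistics -/

section Norms

variable {n : ℕ}

lemma abs_sub_le_diffNorm {h : Fin n → ℕ → ℝ} {B : ℝ} (hB : ∀ i j, |h i j| ≤ B) (i : Fin n)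
    (j : ℕ) : |h i (j + 1) - h i j| ≤ diffNorm h := by
  have h1 : |h i (j + 1) - h i j| ≤ ⨆ j, |h i (j + 1) - h i j| := by
    refine le_ciSup (f := fun j => |h i (j + 1) - h i j|) ⟨2 * B, ?_⟩ j
    rintro _ ⟨j, rfl⟩
    have := abs_sub (h i (j + 1)) (h i j)
    simp only
    linarith [hB i (j + 1), hB i j]
  exact h1.trans (le_ciSup (f := fun i => ⨆ j, |h i (j + 1) - h i j|)
    (Set.finite_range _).bddAbove i)

lemma IsProbVector.one_le_mul_maxProb {p : Fin n → ℝ} (hp : IsProbVector p) :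
    1 ≤ n * maxProb p := by
  rw [← hp.2]
  exact (Finset.sum_le_sum fun i _ => le_maxProb p i).trans (by simp)

lemma IsProbVector.maxProb_nonneg {p : Fin n → ℝ} (hp : IsProbVector p) : 0 ≤ maxProb p :=
  Real.iSup_nonneg hp.1

/-- The factor `√m (1 + m p̄)` in terms of the number of boxes and the mean occupancy `m p̄`. -/
lemma IsProbVector.sqrt_mul_le {p : Fin n → ℝ} (hp : IsProbVector p) (m : ℕ) :
    √m * (1 + 12 * (m * maxProb p))
      ≤ √n * (1 + 13 * (m * maxProb p) + 12 * (m * maxProb p) ^ 2) := by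
  set a := m * maxProb p with ha
  have ha0 : 0 ≤ a := mul_nonneg (Nat.cast_nonneg m) hp.maxProb_nonneg
  have hm : (m : ℝ) ≤ n * a := by
    have := mul_le_mul_of_nonneg_left hp.one_le_mul_maxProb (Nat.cast_nonneg (α := ℝ) m)
    rw [ha]
    linarith
  have h1 : √m ≤ √n * (1 + a) := by
    calc √m ≤ √(n * a) := Real.sqrt_le_sqrt hm
      _ = √n * √a := Real.sqrt_mul (Nat.cast_nonneg n) a
      _ ≤ √n * (1 + a) := by
        gcongr
        rw [Real.sqrt_le_left (by positivity)]
        nlinarith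
  calc √m * (1 + 12 * a) ≤ √n * (1 + a) * (1 + 12 * a) := by gcongr
    _ = _ := by ring

end Norms

/-- The explicit bound; the hypotheses give `1 + 10 m p̄ ≤ 4 L`, so that `4096 L ^ 6` dominates
the quadratic factor in `m p̄` of `IsProbVector.sqrt_mul_le`. -/
theorem kolmogorovDist_standardize_le_log {Ω : Type*} [MeasurableSpace Ω] {P : Measure Ω}
    [IsProbabilityMeasure P] {m n : ℕ} {p : Fin n → ℝ} {X : Fin m → Ω → Fin n}
    {h : Fin n → ℕ → ℝ} {σ : ℝ} (hp : IsProbVector p) (hX : IsOccupancyScheme P p X) {B : ℝ}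
    (hB : ∀ i j, |h i j| ≤ B) (hσ : σ = √(variance (statistic X h) P)) (hσ0 : 0 < σ)
    (hM : 1 ≤ diffNorm h)
    (hl : 1 + 10 * (m : ℝ) * maxProb p ≤ 4 * Real.log (n * supNorm h)) :
    kolmogorovDist (P.map (standardize P (statistic X h))) (gaussianReal 0 1)
      ≤ 409600 * n * diffNorm h ^ 3 * Real.log (n * supNorm h) ^ 6 * (1 + σ ^ 2 / n) / σ ^ 3
        + 3888 * Real.log (n * supNorm h) ^ 2 / σ ^ 2 := by
  set M := diffNorm h
  set L := Real.log (n * supNorm h)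
  have hn : (0 : ℝ) < n := by
    have h1 := hp.one_le_mul_maxProb
    rcases Nat.eq_zero_or_pos n with rfl | hn
    · norm_num at h1
    · exact_mod_cast hn
  have hv : 0 < variance (statistic X h) P := by
    rw [hσ] at hσ0
    exact Real.sqrt_pos.1 hσ0
  have hvσ : variance (statistic X h) P = σ ^ 2 := by rw [hσ, Real.sq_sqrt hv.le]
  refine (kolmogorovDist_standardize_le hp hX (abs_sub_le_diffNorm hB) hv).trans ?_
  rw [hvσ]
  have ha0 : 0 ≤ m * maxProb p := mul_nonneg (Nat.cast_nonneg m) hp.maxProb_nonneg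
  have hfac := hp.sqrt_mul_le m
  set a := m * maxProb p with ha
  rw [show 1 + 10 * (m : ℝ) * maxProb p = 1 + 10 * a by rw [ha]; ring] at hl
  have hpow : 1 + 13 * a + 12 * a ^ 2 ≤ 4096 * L ^ 6 := by
    calc 1 + 13 * a + 12 * a ^ 2 ≤ (1 + 10 * a) ^ 2 := by nlinarith
      _ ≤ (1 + 10 * a) ^ 6 := pow_le_pow_right₀ (by linarith) (by norm_num)
      _ ≤ (4 * L) ^ 6 := by gcongr
      _ = 4096 * L ^ 6 := by ring
  have hL6 : 0 ≤ L ^ 6 := by positivity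
  have hM2 : M ^ 2 ≤ M ^ 3 := pow_le_pow_right₀ hM (by norm_num)
  have hsq : √(n : ℝ) ^ 2 = n := Real.sq_sqrt hn.le
  -- the term `1 + σ² / n` enters only through `n + σ² ≥ 2 √n σ`
  have hamgm : 2 * √(n : ℝ) * σ ≤ n + σ ^ 2 := by nlinarith [sq_nonneg (√(n : ℝ) - σ)]
  have hkey : 24 * M ^ 2 * √m * (1 + 12 * a) * σ ≤ 409600 * M ^ 3 * L ^ 6 * (n + σ ^ 2) := by
    calc 24 * M ^ 2 * √m * (1 + 12 * a) * σ
        = 24 * M ^ 2 * (√m * (1 + 12 * a)) * σ := by ring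
      _ ≤ 24 * M ^ 3 * (√n * (4096 * L ^ 6)) * σ := by
          have h3 := hfac.trans (mul_le_mul_of_nonneg_left hpow (Real.sqrt_nonneg n))
          refine mul_le_mul_of_nonneg_right (mul_le_mul ?_ h3 ?_ ?_) hσ0.le
          · linarith
          all_goals positivity
      _ = 49152 * (M ^ 3 * L ^ 6) * (2 * √n * σ) := by ring
      _ ≤ 409600 * (M ^ 3 * L ^ 6) * (n + σ ^ 2) := by gcongr; norm_num
      _ = _ := by ring
  have h2 : 0 ≤ 3888 * L ^ 2 / σ ^ 2 := by positivity
  refine le_trans ?_ (le_add_of_nonneg_right h2)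
  calc 24 * M ^ 2 * √m * (1 + 12 * a) / σ ^ 2
      = 24 * M ^ 2 * √m * (1 + 12 * a) * σ / σ ^ 3 := by
        field_simp
    _ ≤ 409600 * M ^ 3 * L ^ 6 * (n + σ ^ 2) / σ ^ 3 := by gcongr
    _ = _ := by
        field_simp

theorem tendstoInDistribution_standardize {Ω : ℕ → Type*} [∀ k, MeasurableSpace (Ω k)]
    {P : (k : ℕ) → Measure (Ω k)} [∀ k, IsProbabilityMeasure (P k)] {m n : ℕ → ℕ}
    {p : (k : ℕ) → Fin (n k) → ℝ} {X : (k : ℕ) → Fin (m k) → Ω k → Fin (n k)}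
    {h : (k : ℕ) → Fin (n k) → ℕ → ℝ} (hn : Tendsto n atTop atTop)
    (hp : ∀ k, IsProbVector (p k)) (hX : ∀ k, IsOccupancyScheme (P k) (p k) (X k))
    (hv : ∀ k, 0 < variance (statistic (X k) (h k)) (P k)) {B : ℝ}
    (hB : ∀ k i j, |h k i (j + 1) - h k i j| ≤ B)
    (hO : (fun k => (m k : ℝ) * maxProb (p k)) =O[atTop] fun k => Real.log (n k : ℝ))
    (hlim : Tendsto (fun k => Real.log (n k : ℝ) ^ 4 * (n k : ℝ) ^ (2 / 3 : ℝ)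
      / variance (statistic (X k) (h k)) (P k)) atTop (𝓝 0)) :
    TendstoInDistribution (fun k => standardize (P k) (statistic (X k) (h k)))
      atTop (id : ℝ → ℝ) P (gaussianReal 0 1) := by
  refine ⟨fun k => ((hX k).measurable_standardize (h k)).aemeasurable, aemeasurable_id, ?_⟩
  apply tendsto_of_tendsto_kolmogorovDist
  simp only [ProbabilityMeasure.coe_mk, Measure.map_id]
  obtain ⟨C, hC0, hC⟩ := hO.exists_nonneg
  have hC := hC.bound
  refine squeeze_zero' (g := fun k => 24 * B ^ 2 * (1 + 13 * C + 12 * C ^ 2) *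
    (Real.log (n k : ℝ) ^ 4 * (n k : ℝ) ^ (2 / 3 : ℝ)
      / variance (statistic (X k) (h k)) (P k))) ?_ ?_ (by simpa using hlim.const_mul _)
  · exact Eventually.of_forall fun k => Real.iSup_nonneg fun x => abs_nonneg _
  · filter_upwards [hC, hn.eventually_ge_atTop 3] with k hk hnk
    have hlog : 1 ≤ Real.log (n k) := by
      rw [Real.le_log_iff_exp_le (by positivity)]
      have : (3 : ℝ) ≤ n k := by exact_mod_cast hnk
      linarith [Real.exp_one_lt_d9]
    have hn1 : (1 : ℝ) ≤ n k := by
      have : 1 ≤ n k := by omega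
      exact_mod_cast this
    have ha0 : 0 ≤ m k * maxProb (p k) :=
      mul_nonneg (Nat.cast_nonneg _) (hp k).maxProb_nonneg
    have hfac := (hp k).sqrt_mul_le (m k)
    rw [Real.norm_of_nonneg ha0, Real.norm_of_nonneg (by linarith)] at hk
    refine (kolmogorovDist_standardize_le (hp k) (hX k) (hB k) (hv k)).trans ?_
    set a := m k * maxProb (p k)
    set L := Real.log (n k)
    have hroot : √(n k : ℝ) ≤ (n k : ℝ) ^ (2 / 3 : ℝ) := by
      rw [Real.sqrt_eq_rpow]
      exact Real.rpow_le_rpow_of_exponent_le hn1 (by norm_num)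
    have hpoly : 1 + 13 * a + 12 * a ^ 2 ≤ (1 + 13 * C + 12 * C ^ 2) * L ^ 4 := by
      have e1 : 1 ≤ L ^ 4 := one_le_pow₀ hlog
      have e2 : L ≤ L ^ 4 := le_self_pow₀ hlog (by norm_num)
      have e3 : L ^ 2 ≤ L ^ 4 := pow_le_pow_right₀ hlog (by norm_num)
      calc 1 + 13 * a + 12 * a ^ 2 ≤ 1 + 13 * (C * L) + 12 * (C * L) ^ 2 := by gcongr
        _ = 1 + 13 * C * L + 12 * C ^ 2 * L ^ 2 := by ring
        _ ≤ L ^ 4 + 13 * C * L ^ 4 + 12 * C ^ 2 * L ^ 4 := by gcongr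
        _ = _ := by ring
    rw [← mul_div_assoc]
    refine div_le_div_of_nonneg_right ?_ (hv k).le
    calc 24 * B ^ 2 * √(m k) * (1 + 12 * a) = 24 * B ^ 2 * (√(m k) * (1 + 12 * a)) := by ring
      _ ≤ 24 * B ^ 2 * ((n k : ℝ) ^ (2 / 3 : ℝ) * ((1 + 13 * C + 12 * C ^ 2) * L ^ 4)) := by
          refine mul_le_mul_of_nonneg_left (hfac.trans ?_) (by positivity)
          gcongr
      _ = _ := by ring

end Occupancy

theorem mainTheorem7 :
    (∀ (Ω : Type*) [MeasurableSpace Ω] (P : Measure Ω) [IsProbabilityMeasure P]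
      (m n : ℕ) (p : Fin n → ℝ) (X : Fin m → Ω → Fin n) (h : Fin n → ℕ → ℝ) (σ : ℝ),
      Occupancy.IsProbVector p →
      Occupancy.IsOccupancyScheme P p X →
      (∀ i, h i 0 = 0) →
      (∃ B : ℝ, ∀ i j, |h i j| ≤ B) →
      σ = √(variance (Occupancy.statistic X h) P) →
      0 < σ →
      1 ≤ Occupancy.supNorm h →
      1 ≤ Occupancy.diffNorm h →
      1 + 10 * (m : ℝ) * Occupancy.maxProb p
        ≤ 4 * Real.log ((n : ℝ) * Occupancy.supNorm h) →
      4 * Real.log ((n : ℝ) * Occupancy.supNorm h) ≤ 1 / √(2 * Occupancy.maxProb p) →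
      Occupancy.kolmogorovDist
          (P.map (Occupancy.standardize P (Occupancy.statistic X h))) (gaussianReal 0 1)
        ≤ 409600 * (n : ℝ) * Occupancy.diffNorm h ^ 3
              * Real.log ((n : ℝ) * Occupancy.supNorm h) ^ 6 * (1 + σ ^ 2 / (n : ℝ)) / σ ^ 3
          + 3888 * Real.log ((n : ℝ) * Occupancy.supNorm h) ^ 2 / σ ^ 2)
    ∧
    (∀ (Ω : ℕ → Type*) [∀ k, MeasurableSpace (Ω k)] (P : (k : ℕ) → Measure (Ω k))
      [∀ k, IsProbabilityMeasure (P k)]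
      (m n : ℕ → ℕ) (p : (k : ℕ) → Fin (n k) → ℝ)
      (X : (k : ℕ) → Fin (m k) → Ω k → Fin (n k)) (h : (k : ℕ) → Fin (n k) → ℕ → ℝ),
      Tendsto n atTop atTop →
      (∀ k, Occupancy.IsProbVector (p k)) →
      (∀ k, Occupancy.IsOccupancyScheme (P k) (p k) (X k)) →
      (∀ k, 0 < variance (Occupancy.statistic (X k) (h k)) (P k)) →
      (∃ B : ℝ, ∀ k i j, |h k i (j + 1) - h k i j| ≤ B) →
      ((fun k => (m k : ℝ) * Occupancy.maxProb (p k)) =O[atTop]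
        fun k => Real.log (n k : ℝ)) →
      Tendsto (fun k => Real.log (n k : ℝ) ^ 4 * (n k : ℝ) ^ (2 / 3 : ℝ)
        / variance (Occupancy.statistic (X k) (h k)) (P k)) atTop (𝓝 0) →
      ((fun k => Occupancy.maxProb (p k)) =O[atTop]
        fun k => (Real.log (n k : ℝ) ^ 2)⁻¹) →
      TendstoInDistribution
        (fun k => Occupancy.standardize (P k) (Occupancy.statistic (X k) (h k)))
        atTop (id : ℝ → ℝ) P (gaussianReal 0 1)) := by
  constructor
  · rintro Ω _ P _ m n p X h σ hp hX - ⟨B, hB⟩ hσ hσ0 - hM hl -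
    exact Occupancy.kolmogorovDist_standardize_le_log hp hX hB hσ hσ0 hM hl
  · rintro Ω _ P _ m n p X h hn hp hX hv ⟨B, hB⟩ hO hlim -
    exact Occupancy.tendstoInDistribution_standardize hn hp hX hv hB hO hlim
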